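/- \textbf{Conventions.} For a finite group $G$ and a finite multiset $S$ of elements of $G$, $\mathrm{Cay}(G,S)$ is the undirected $2|S|$-regular multigraph with vertex set $G$ and one edge $\{x,xs\}$ for each $x\in G$ and each $s\in S$ (counted with multiplicity). Its normalized adjacency operator is $(M_Sv)(x)=\frac1{2|S|}\sum_{s\in S}\big(v(xs)+v(xs^{-1})\big)$ for $v:G\to\mathbb C$; if each element occurs in $S$ as often as its inverse, then $(M_Sv)(x)=\frac1{|S|}\sum_{s\in S}v(xs)$. The graph is a $\lambda$-spectral expander if $\|M_Sv\|_2\le\lambda\|v\|_2$ for all $v$ with $\sum_{x}v(x)=0$. All generating sets are multisets, and cardinalities and images of multisets are taken with multiplicity. Algorithms are deterministic random access machine programs with a memory of natural numbers and a memory of group elements. One step is one of the following: writing a constant, an addition, a truncated subtraction, an indirect load or an indirect store of numbers, writing the identity, a multiplication or an inversion of stored group elements (addressed indirectly), or testing whether a number is zero in an if-then-else or a while loop. Thus each group operation counts as one step, and group elements are accessed only through the group operations. \textbf{Statement.} There are a single such program, a polynomial $T$ and a constant $C$ with the following property. Let $G$ be a finite group, $N$ a normal subgroup of $G$, $A$ a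 finite multiset of elements of $N$ and $B$ a finite multiset of elements of $G$, and let $\hat B=\{Nx \mid x\in B\}$ be the image multiset of $B$ in $G/N$. Suppose that $N=\langle A\rangle$ and $\mathrm{Cay}(N,A)$ is a $1/4$-spectral expander, and that $G/N=\langle\hat B\rangle$ and $\mathrm{Cay}(G/N,\hat B)$ is a $1/4$-spectral expander. Then, given $A$ and $B$ as lists of group elements in any order, the program halts after at most $T(|A|+|B|)$ steps and outputs a list $S$ of elements of $G$ with $|S|\le C\,(|A|+|B|)$ such that each element occurs in $S$ as often as its inverse, $S$ generates $G$, and $\mathrm{Cay}(G,S)$ is a $1/4$-spectral expander. -/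

import Mathlib

/-! ### Expanding generating multisets -/

/-- The normalized adjacency operator of the undirected Cayley multigraph `Cay(G, S)`, whose edges
are `{x, x * s}`, one for each `x : G` and each `s ∈ S` (with multiplicity); this graph is
`2 |S|`-regular. If `S` is closed under inverses (with multiplicities), this is the operator
`v ↦ (1 / |S|) ∑_{s ∈ S} v (x * s)`. -/
noncomputable def cayleyOp {G : Type*} [Group G] (S : Multiset G) (v : G → ℂ) : G → ℂ :=
  fun x => (2 * (Multiset.card S : ℂ))⁻¹ * (S.map fun s => v (x * s) + v (x * s⁻¹)).sum

/-- `Cay(G, S)` is a `lam`-spectral expander: its normalized adjacency operator contracts the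
Euclidean norm by the factor `lam` on the orthogonal complement of the constant vectors. (The
operator is self-adjoint, so this bounds the absolute values of all the other eigenvalues.) -/
def IsSpectralExpander {G : Type*} [Group G] [Fintype G] (lam : ℝ) (S : Multiset G) : Prop :=
  ∀ v : G → ℂ, ∑ x, v x = 0 → ‖WithLp.toLp 2 (cayleyOp S v)‖ ≤ lam * ‖WithLp.toLp 2 v‖

/-- `S` is a generating multiset of `G` for which `Cay(G, S)` is a `lam`-spectral expander. -/
structure IsExpandingGenerating {G : Type*} [Group G] [Fintype G] (lam : ℝ) (S : Multiset G) :
    Prop where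
  generates : Subgroup.closure {g : G | g ∈ S} = ⊤
  spectral : IsSpectralExpander lam S

/-- Each element occurs in the multiset `S` as often as its inverse. -/
def IsInverseClosed {G : Type*} [Group G] (S : Multiset G) : Prop :=
  S.map (fun s => s⁻¹) = S

/-! ### Random access machines over a group

A machine has a memory of natural numbers and a memory of group elements. A program does not depend
on the group: it accesses group elements only through the group operations. -/

namespace GroupRAM

/-- The primitive instructions. Memory cells of group elements are addressed through the contents of
number cells. -/
inductive Instr : Type
  | const (i k : ℕ)   -- num[i] := k
  | add (i j k : ℕ)   -- num[i] := num[j] + num[k]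
  | sub (i j k : ℕ)   -- num[i] := num[j] - num[k], truncated at 0
  | load (i j : ℕ)    -- num[i] := num[num[j]]
  | store (i j : ℕ)   -- num[num[i]] := num[j]
  | one (i : ℕ)       -- grp[num[i]] := 1
  | mul (i j k : ℕ)   -- grp[num[i]] := grp[num[j]] * grp[num[k]]
  | inv (i j : ℕ)     -- grp[num[i]] := (grp[num[j]])⁻¹

/-- Programs. -/
inductive Program : Type
  | instr (a : Instr)
  | seq (p q : Program)           -- p; q
  | ite (i : ℕ) (p q : Program)   -- if num[i] ≠ 0 then p else q
  | loop (i : ℕ) (p : Program)    -- while num[i] ≠ 0 do p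

/-- Memory contents. -/
structure State (G : Type*) where
  num : ℕ → ℕ
  grp : ℕ → G

/-- The effect of one instruction. -/
def Instr.exec {G : Type*} [Group G] (s : State G) : Instr → State G
  | .const i k => { s with num := Function.update s.num i k }
  | .add i j k => { s with num := Function.update s.num i (s.num j + s.num k) }
  | .sub i j k => { s with num := Function.update s.num i (s.num j - s.num k) }
  | .load i j => { s with num := Function.update s.num i (s.num (s.num j)) }
  | .store i j => { s with num := Function.update s.num (s.num i) (s.num j) }
  | .one i => { s with grp := Function.update s.grp (s.num i) 1 }
  | .mul i j k =>
      { s with grp := Function.update s.grp (s.num i) (s.grp (s.num j) * s.grp (s.num k)) }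
  | .inv i j => { s with grp := Function.update s.grp (s.num i) (s.grp (s.num j))⁻¹ }

/-- `Run p s t s'`: started in the state `s`, the program `p` halts after exactly `t` steps in the
state `s'`. Every instruction and every test of a branching or a loop is one step. -/
inductive Run {G : Type*} [Group G] : Program → State G → ℕ → State G → Prop
  | instr (a : Instr) (s : State G) : Run (.instr a) s 1 (a.exec s)
  | seq {p q : Program} {s s' s'' : State G} {t t' : ℕ} :
      Run p s t s' → Run q s' t' s'' → Run (.seq p q) s (t + t') s''
  | ite_true {i : ℕ} {p q : Program} {s s' : State G} {t : ℕ} :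
      s.num i ≠ 0 → Run p s t s' → Run (.ite i p q) s (t + 1) s'
  | ite_false {i : ℕ} {p q : Program} {s s' : State G} {t : ℕ} :
      s.num i = 0 → Run q s t s' → Run (.ite i p q) s (t + 1) s'
  | loop_step {i : ℕ} {p : Program} {s s' s'' : State G} {t t' : ℕ} :
      s.num i ≠ 0 → Run p s t s' → Run (.loop i p) s' t' s'' →
        Run (.loop i p) s (t + t' + 1) s''
  | loop_done {i : ℕ} {p : Program} {s : State G} :
      s.num i = 0 → Run (.loop i p) s 1 s

/-- Runs are deterministic. -/
theorem Run.det {G : Type*} [Group G] {p : Program} {s s₁ s₂ : State G} {t₁ t₂ : ℕ}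
    (h₁ : Run p s t₁ s₁) (h₂ : Run p s t₂ s₂) : t₁ = t₂ ∧ s₁ = s₂ := by
  induction h₁ generalizing t₂ s₂ with
  | instr a s => cases h₂; exact ⟨rfl, rfl⟩
  | seq _ _ ih ih' =>
    cases h₂ with
    | seq a b => obtain ⟨rfl, rfl⟩ := ih a; obtain ⟨rfl, rfl⟩ := ih' b; exact ⟨rfl, rfl⟩
  | ite_true h _ ih =>
    cases h₂ with
    | ite_true _ a => obtain ⟨rfl, rfl⟩ := ih a; exact ⟨rfl, rfl⟩
    | ite_false h' _ => exact absurd h' h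
  | ite_false h _ ih =>
    cases h₂ with
    | ite_true h' _ => exact absurd h h'
    | ite_false _ a => obtain ⟨rfl, rfl⟩ := ih a; exact ⟨rfl, rfl⟩
  | loop_step h _ _ ih ih' =>
    cases h₂ with
    | loop_step _ a b => obtain ⟨rfl, rfl⟩ := ih a; obtain ⟨rfl, rfl⟩ := ih' b; exact ⟨rfl, rfl⟩
    | loop_done h' => exact absurd h' h
  | loop_done h =>
    cases h₂ with
    | loop_step h' _ _ => exact absurd h h'
    | loop_done _ => exact ⟨rfl, rfl⟩

/-- The initial state on input `A`, `B`: the lengths are in the first two number cells, the entries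
of `A` followed by those of `B` are in the first group cells; all other number cells contain `0` and
all other group cells contain `1`. -/
def input {G : Type*} [Group G] (A B : List G) : State G where
  num := fun i => if i = 0 then A.length else if i = 1 then B.length else 0
  grp := fun i => (A ++ B).getD i 1

/-- The output list of a state: `num[0]` is its length and its entries are in the first group
cells. -/
def output {G : Type*} (s : State G) : List G :=
  (List.range (s.num 0)).map s.grp

/-- On input `A`, `B` the program `p` halts after exactly `t` steps with output `S`. -/
def Computes {G : Type*} [Group G] (p : Program) (A B : List G) (t : ℕ) (S : List G) : Prop :=
  ∃ s : State G, Run p (input A B) t s ∧ output s = S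

end GroupRAM

section L2

variable {ι κ : Type*} [Fintype ι] [Fintype κ]

/-- The Euclidean norm of a complex function on a finite type. -/
noncomputable def l2norm (f : ι → ℂ) : ℝ := ‖(WithLp.toLp 2 f : EuclideanSpace ℂ ι)‖

theorem l2norm_sq (f : ι → ℂ) : l2norm f ^ 2 = ∑ i, ‖f i‖ ^ 2 := EuclideanSpace.norm_sq_eq _

theorem l2norm_nonneg (f : ι → ℂ) : 0 ≤ l2norm f := norm_nonneg _

theorem l2norm_add_le (f g : ι → ℂ) : l2norm (f + g) ≤ l2norm f + l2norm g := by
  simpa [l2norm] using norm_add_le (WithLp.toLp 2 f : EuclideanSpace ℂ ι) (WithLp.toLp 2 g)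

theorem l2norm_sub_comm (f g : ι → ℂ) : l2norm (f - g) = l2norm (g - f) := by
  simpa [l2norm] using norm_sub_rev (WithLp.toLp 2 f : EuclideanSpace ℂ ι) (WithLp.toLp 2 g)

theorem l2norm_smul (c : ℂ) (f : ι → ℂ) : l2norm (c • f) = ‖c‖ * l2norm f := by
  simpa [l2norm] using norm_smul c (WithLp.toLp 2 f : EuclideanSpace ℂ ι)

@[simp] theorem l2norm_zero : l2norm (0 : ι → ℂ) = 0 := by simp [l2norm]

theorem l2norm_eq_zero {f : ι → ℂ} : l2norm f = 0 ↔ f = 0 := by simp [l2norm]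

theorem l2norm_sum_le {α : Type*} (s : Finset α) (f : α → ι → ℂ) :
    l2norm (∑ a ∈ s, f a) ≤ ∑ a ∈ s, l2norm (f a) := by
  simpa [l2norm] using norm_sum_le s fun a => (WithLp.toLp 2 (f a) : EuclideanSpace ℂ ι)

theorem l2norm_comp_equiv (σ : κ ≃ ι) (f : ι → ℂ) : l2norm (f ∘ σ) = l2norm f := by
  refine (pow_left_inj₀ (l2norm_nonneg _) (l2norm_nonneg _) two_ne_zero).1 ?_
  rw [l2norm_sq, l2norm_sq]
  exact σ.sum_comp fun i => ‖f i‖ ^ 2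

theorem l2norm_le_of_sq_le {f : ι → ℂ} {c : ℝ} (hc : 0 ≤ c) (h : ∑ i, ‖f i‖ ^ 2 ≤ c ^ 2) :
    l2norm f ≤ c := by
  rw [← l2norm_sq] at h
  exact (pow_le_pow_iff_left₀ (l2norm_nonneg _) hc two_ne_zero).1 h

theorem l2norm_half_add_sq (f g : ι → ℂ) (h : l2norm g = l2norm f) :
    l2norm ((2⁻¹ : ℂ) • (f + g)) ^ 2 = l2norm f ^ 2 - l2norm (g - f) ^ 2 / 4 := by
  have := parallelogram_law_with_norm ℂ (WithLp.toLp 2 f : EuclideanSpace ℂ ι) (WithLp.toLp 2 g)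
  rw [l2norm_smul, l2norm_sub_comm]
  simp only [l2norm, WithLp.toLp_add, WithLp.toLp_sub] at *
  rw [h] at this
  rw [mul_pow]
  norm_num
  linarith

theorem sum_norm_mul_le (f g : ι → ℂ) : ∑ i, ‖f i‖ * ‖g i‖ ≤ l2norm f * l2norm g := by
  refine abs_le_of_sq_le_sq' ?_ (mul_nonneg (l2norm_nonneg _) (l2norm_nonneg _)) |>.2
  rw [mul_pow, l2norm_sq, l2norm_sq]
  exact Finset.sum_mul_sq_le_sq_mul_sq _ _ _

/-- The part of the squared norm of `F` that is supported on `X`. -/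
noncomputable def mass (F : ι → ℂ) (X : Finset ι) : ℝ := ∑ z ∈ X, ‖F z‖ ^ 2

theorem mass_mono {ι : Type*} (F : ι → ℂ) {X Y : Finset ι} (h : X ⊆ Y) : mass F X ≤ mass F Y :=
  Finset.sum_le_sum_of_subset_of_nonneg h fun _ _ _ => sq_nonneg _

theorem mass_union_le {ι : Type*} [DecidableEq ι] (F : ι → ℂ) (X Y : Finset ι) :
    mass F (X ∪ Y) ≤ mass F X + mass F Y := by
  have := Finset.sum_union_inter (s₁ := X) (s₂ := Y) (f := fun z => ‖F z‖ ^ 2)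
  have h : 0 ≤ mass F (X ∩ Y) := Finset.sum_nonneg fun _ _ => sq_nonneg _
  unfold mass at *
  linarith

theorem mass_le_of_mapsTo (F : ι → ℂ) (σ : ι ≃ ι) {X Y : Finset ι} (h : ∀ z ∈ X, σ z ∈ Y) {D : ℝ}
    (hD : l2norm (F ∘ σ - F) ≤ D) : mass F X ≤ mass F Y + 2 * D * l2norm F := by
  have h1 : ∑ z ∈ X, ‖F (σ z)‖ ^ 2 ≤ mass F Y := by
    classical
    have : ∑ z ∈ X, ‖F (σ z)‖ ^ 2 = mass F (X.map σ.toEmbedding) := by simp [mass]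
    rw [this]
    refine mass_mono F fun z hz => ?_
    obtain ⟨w, hw, rfl⟩ := Finset.mem_map.1 hz
    exact h w hw
  have h2 : mass F X - ∑ z ∈ X, ‖F (σ z)‖ ^ 2 ≤
      ∑ z, (‖(F ∘ σ - F) z‖ * ‖(F ∘ σ) z‖ + ‖(F ∘ σ - F) z‖ * ‖F z‖) := by
    rw [mass, ← Finset.sum_sub_distrib]
    refine (Finset.sum_le_sum fun z _ => ?_).trans
      (Finset.sum_le_sum_of_subset_of_nonneg (Finset.subset_univ X) fun _ _ _ => by positivity)
    have := abs_norm_sub_norm_le (F (σ z)) (F z)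
    rw [abs_le] at this
    simp only [Function.comp_apply, Pi.sub_apply]
    nlinarith [norm_nonneg (F (σ z)), norm_nonneg (F z)]
  rw [Finset.sum_add_distrib] at h2
  have h3 := sum_norm_mul_le (F ∘ σ - F) (F ∘ σ)
  have h4 := sum_norm_mul_le (F ∘ σ - F) F
  rw [l2norm_comp_equiv] at h3
  have := mul_le_mul_of_nonneg_right hD (l2norm_nonneg F)
  linarith

/-- A set that is mapped, up to a small exceptional set, into one of two disjoint halves of itself
which an almost invariance exchanges, carries little mass. -/
theorem mass_le_of_pingPong [DecidableEq ι] (F : ι → ℂ) (σ s : ι ≃ ι) {X X₁ X₂ O : Finset ι}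
    {D : ℝ} (hσ : l2norm (F ∘ σ - F) ≤ D) (hs : l2norm (F ∘ s - F) ≤ D)
    (h : ∀ z ∈ X \ O, σ z ∈ X₁) (h₁ : X₁ ⊆ X) (h₂ : X₂ ⊆ X) (hd : Disjoint X₁ X₂)
    (h₁₂ : ∀ z ∈ X₁, s z ∈ X₂) : mass F X ≤ 6 * D * l2norm F + 2 * mass F O := by
  have a := mass_le_of_mapsTo F σ h hσ
  have b := mass_le_of_mapsTo F s h₁₂ hs
  have c : mass F X₁ + mass F X₂ ≤ mass F X := by
    rw [mass, mass, ← Finset.sum_union hd]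
    exact mass_mono F (Finset.union_subset h₁ h₂)
  have d := (mass_mono F (by simp : X ⊆ X \ O ∪ O)).trans (mass_union_le F (X \ O) O)
  linarith

end L2

section Torus

variable {m : ℕ}

/-- The map `(a, b) ↦ (b - a, a)` of the discrete torus. -/
def torusShear (m : ℕ) : ZMod m × ZMod m ≃ ZMod m × ZMod m where
  toFun p := (p.2 - p.1, p.1)
  invFun p := (p.2, p.1 + p.2)
  left_inv p := by simp
  right_inv p := by simp

/-- The points of the torus one of whose coordinates is far from zero. -/
def torusFar (m : ℕ) [NeZero m] : Finset (ZMod m × ZMod m) :=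
  Finset.univ.filter fun p => (m : ℤ) ≤ 4 * |p.1.valMinAbs| ∨ (m : ℤ) ≤ 4 * |p.2.valMinAbs|

theorem ZMod.valMinAbs_sub_of_small [NeZero m] {a b : ZMod m} (ha : 4 * |a.valMinAbs| < m)
    (hb : 4 * |b.valMinAbs| < m) : (b - a).valMinAbs = b.valMinAbs - a.valMinAbs := by
  rw [ZMod.valMinAbs_spec]
  refine ⟨by simp, ?_⟩
  have h1 := abs_le.1 (le_refl |a.valMinAbs|)
  have h2 := abs_le.1 (le_refl |b.valMinAbs|)
  constructor <;> linarith

theorem ZMod.valMinAbs_add_of_small [NeZero m] {a b : ZMod m} (ha : 4 * |a.valMinAbs| < m)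
    (hb : 4 * |b.valMinAbs| < m) : (a + b).valMinAbs = a.valMinAbs + b.valMinAbs := by
  rw [ZMod.valMinAbs_spec]
  refine ⟨by simp, ?_⟩
  have h1 := abs_le.1 (le_refl |a.valMinAbs|)
  have h2 := abs_le.1 (le_refl |b.valMinAbs|)
  constructor <;> linarith

theorem l2norm_le_of_torus [NeZero m] (F : ZMod m × ZMod m → ℂ) (h0 : F 0 = 0) {D : ℝ}
    (hσ : l2norm (F ∘ torusShear m - F) ≤ D)
    (hs : l2norm (F ∘ Equiv.prodComm (ZMod m) (ZMod m) - F) ≤ D)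
    (hO : mass F (torusFar m) ≤ 4 * D ^ 2) : l2norm F ≤ 70 * D := by
  classical
  have hD : 0 ≤ D := (l2norm_nonneg _).trans hσ
  have hσ' : l2norm (F ∘ (torusShear m).symm - F) ≤ D := by
    rw [← l2norm_comp_equiv (torusShear m)]
    rw [l2norm_sub_comm] at hσ
    convert hσ using 2
    ext p
    simp
  set M := l2norm F with hM
  rcases le_or_gt M D with h | hDM
  · linarith
  let v : ZMod m → ℤ := ZMod.valMinAbs
  let X : Finset (ZMod m × ZMod m) := Finset.univ.filter fun p => v p.1 * v p.2 < 0
  let Y : Finset (ZMod m × ZMod m) := Finset.univ.filter fun p => 0 < v p.1 * v p.2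
  let K : Finset (ZMod m × ZMod m) := Finset.univ.filter fun p => v p.1 ≠ 0 ∧ v p.2 = 0
  let K' : Finset (ZMod m × ZMod m) := Finset.univ.filter fun p => v p.1 = 0 ∧ v p.2 ≠ 0
  have far : ∀ p : ZMod m × ZMod m, p ∉ torusFar m → 4 * |v p.1| < m ∧ 4 * |v p.2| < m := by
    intro p hp
    simpa [torusFar, v] using hp
  have hX : mass F X ≤ 6 * D * M + 2 * mass F (torusFar m) := by
    refine mass_le_of_pingPong F (torusShear m) (Equiv.prodComm _ _) hσ hs
      (X₁ := X.filter fun p => |v p.2| < |v p.1|) (X₂ := X.filter fun p => |v p.1| < |v p.2|)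
      ?_ (Finset.filter_subset _ _) (Finset.filter_subset _ _) ?_ ?_
    · rintro ⟨a, b⟩ hz
      rw [Finset.mem_sdiff] at hz
      obtain ⟨hz, hf⟩ := hz
      obtain ⟨ha, hb⟩ := far _ hf
      have hz : v a * v b < 0 := by simpa [X] using hz
      have e : v (b - a) = v b - v a := ZMod.valMinAbs_sub_of_small ha hb
      simp only [X, torusShear, Equiv.coe_fn_mk, Finset.mem_filter, Finset.mem_univ, true_and, e]
      rcases mul_neg_iff.1 hz with ⟨h1, h2⟩ | ⟨h1, h2⟩
      · refine ⟨by nlinarith, ?_⟩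
        rw [abs_of_pos h1, abs_of_neg (by linarith)]; linarith
      · refine ⟨by nlinarith, ?_⟩
        rw [abs_of_neg h1, abs_of_pos (by linarith)]; linarith
    · rw [Finset.disjoint_filter]; intro p _ h; exact not_lt.2 h.le
    · rintro ⟨a, b⟩ hz
      simpa [X, mul_comm] using hz
  have hY : mass F Y ≤ 6 * D * M + 2 * mass F (torusFar m) := by
    refine mass_le_of_pingPong F (torusShear m).symm (Equiv.prodComm _ _) hσ' hs
      (X₁ := Y.filter fun p => |v p.1| < |v p.2|) (X₂ := Y.filter fun p => |v p.2| < |v p.1|)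
      ?_ (Finset.filter_subset _ _) (Finset.filter_subset _ _) ?_ ?_
    · rintro ⟨a, b⟩ hz
      rw [Finset.mem_sdiff] at hz
      obtain ⟨hz, hf⟩ := hz
      obtain ⟨ha, hb⟩ := far _ hf
      have hz : 0 < v a * v b := by simpa [Y] using hz
      have e : v (a + b) = v a + v b := ZMod.valMinAbs_add_of_small ha hb
      simp only [Y, torusShear, Equiv.coe_fn_symm_mk, Finset.mem_filter, Finset.mem_univ, true_and,
        e]
      rcases mul_pos_iff.1 hz with ⟨h1, h2⟩ | ⟨h1, h2⟩
      · refine ⟨by nlinarith, ?_⟩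
        rw [abs_of_pos h2, abs_of_pos (by linarith)]; linarith
      · refine ⟨by nlinarith, ?_⟩
        rw [abs_of_neg h2, abs_of_neg (by linarith)]; linarith
    · rw [Finset.disjoint_filter]; intro p _ h; exact not_lt.2 h.le
    · rintro ⟨a, b⟩ hz
      simpa [Y, mul_comm] using hz
  have hK : mass F (K \ torusFar m) ≤ mass F X + 2 * D * M := by
    refine mass_le_of_mapsTo F (torusShear m) ?_ hσ
    rintro ⟨a, b⟩ hz
    rw [Finset.mem_sdiff] at hz
    obtain ⟨hz, hf⟩ := hz
    obtain ⟨ha, hb⟩ := far _ hf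
    obtain ⟨h1, h2⟩ : v a ≠ 0 ∧ v b = 0 := by simpa [K] using hz
    have e : v (b - a) = v b - v a := ZMod.valMinAbs_sub_of_small ha hb
    simp only [X, torusShear, Equiv.coe_fn_mk, Finset.mem_filter, Finset.mem_univ, true_and, e, h2]
    have := mul_self_pos.2 h1
    linarith
  have hK2 := (mass_mono F (by simp : K ⊆ K \ torusFar m ∪ torusFar m)).trans
    (mass_union_le F _ _)
  have hK' : mass F K' ≤ mass F K + 2 * D * M := by
    refine mass_le_of_mapsTo F (Equiv.prodComm _ _) ?_ hs
    rintro ⟨a, b⟩ hz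
    simpa [K, K', and_comm] using hz
  have total : M ^ 2 ≤ mass F X + mass F Y + mass F K + mass F K' := by
    have h1 : M ^ 2 = mass F (X ∪ Y ∪ K ∪ K') := by
      rw [hM, l2norm_sq, mass]
      refine (Finset.sum_subset (Finset.subset_univ _) ?_).symm
      rintro ⟨a, b⟩ _ hz
      have hz : ¬ (v a * v b < 0 ∨ 0 < v a * v b ∨ (v a ≠ 0 ∧ v b = 0) ∨ (v a = 0 ∧ v b ≠ 0)) := by
        simpa [X, Y, K, K', or_assoc] using hz
      have : v a = 0 ∧ v b = 0 := by
        have h2 : v a * v b = 0 := by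
          rcases lt_trichotomy (v a * v b) 0 with h | h | h
          · exact absurd (Or.inl h) hz
          · exact h
          · exact absurd (Or.inr (Or.inl h)) hz
        rcases mul_eq_zero.1 h2 with h | h <;> tauto
      simp only [v, ZMod.valMinAbs_eq_zero] at this
      rw [this.1, this.2, show ((0, 0) : ZMod m × ZMod m) = 0 from rfl, h0]
      simp
    rw [h1]
    have a := mass_union_le F (X ∪ Y ∪ K) K'
    have b := mass_union_le F (X ∪ Y) K
    have c := mass_union_le F X Y
    linarith
  have hM0 : 0 < M := hD.trans_lt hDM
  refine le_of_mul_le_mul_right ?_ hM0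
  nlinarith

end Torus

section Fourier

variable {m : ℕ}

/-- The permutation `(x, y) ↦ (y, x + w y)` of the discrete torus. -/
def torusStep (w : ZMod m → ZMod m) : ZMod m × ZMod m ≃ ZMod m × ZMod m where
  toFun p := (p.2, p.1 + w p.2)
  invFun p := (p.2 - w p.1, p.1)
  left_inv p := by simp
  right_inv p := by simp

variable [NeZero m]

/-- The Fourier transform on the discrete torus. -/
noncomputable def torusFourier (f : ZMod m × ZMod m → ℂ) (q : ZMod m × ZMod m) : ℂ :=
  ∑ p : ZMod m × ZMod m, f p * ZMod.stdAddChar (q.1 * p.1 + q.2 * p.2)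

theorem torusFourier_sub (f g : ZMod m × ZMod m → ℂ) :
    torusFourier (f - g) = torusFourier f - torusFourier g := by
  ext q
  simp [torusFourier, sub_mul, Finset.sum_sub_distrib]

theorem sum_stdAddChar_mul (d : ZMod m) :
    ∑ x : ZMod m, ZMod.stdAddChar (x * d) = if d = 0 then (m : ℂ) else 0 := by
  rw [AddChar.sum_mulShift d (ZMod.isPrimitive_stdAddChar m)]
  split_ifs <;> simp

theorem l2norm_torusFourier (f : ZMod m × ZMod m → ℂ) :
    l2norm (torusFourier f) = m * l2norm f := by
  refine (pow_left_inj₀ (l2norm_nonneg _) (mul_nonneg m.cast_nonneg (l2norm_nonneg _))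
    two_ne_zero).1 ?_
  rw [mul_pow, l2norm_sq, l2norm_sq]
  apply Complex.ofReal_injective
  push_cast
  simp only [← Complex.mul_conj']
  calc ∑ q, torusFourier f q * (starRingEnd ℂ) (torusFourier f q)
      = ∑ q : ZMod m × ZMod m, ∑ p, ∑ p', f p * (starRingEnd ℂ) (f p') *
          (ZMod.stdAddChar (q.1 * (p.1 - p'.1)) * ZMod.stdAddChar (q.2 * (p.2 - p'.2))) := by
        refine Finset.sum_congr rfl fun q _ => ?_
        rw [torusFourier, map_sum, Finset.sum_mul_sum]
        refine Finset.sum_congr rfl fun p _ => Finset.sum_congr rfl fun p' _ => ?_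
        have hχ : (ZMod.stdAddChar (q.1 * (p.1 - p'.1)) * ZMod.stdAddChar (q.2 * (p.2 - p'.2)) : ℂ) =
            ZMod.stdAddChar (q.1 * p.1 + q.2 * p.2) *
              ZMod.stdAddChar (-(q.1 * p'.1 + q.2 * p'.2)) := by
          rw [← AddChar.map_add_eq_mul, ← AddChar.map_add_eq_mul]
          ring_nf
        rw [map_mul, ← AddChar.map_neg_eq_conj, hχ]
        ring
    _ = ∑ p, ∑ p', f p * (starRingEnd ℂ) (f p') *
          ∑ q : ZMod m × ZMod m, ZMod.stdAddChar (q.1 * (p.1 - p'.1)) *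
            ZMod.stdAddChar (q.2 * (p.2 - p'.2)) := by
        rw [Finset.sum_comm]
        refine Finset.sum_congr rfl fun p _ => ?_
        rw [Finset.sum_comm]
        refine Finset.sum_congr rfl fun p' _ => ?_
        rw [Finset.mul_sum]
    _ = ∑ p, ∑ p', f p * (starRingEnd ℂ) (f p') * if p' = p then (m : ℂ) ^ 2 else 0 := by
        refine Finset.sum_congr rfl fun p _ => Finset.sum_congr rfl fun p' _ => ?_
        congr 1
        rw [Fintype.sum_prod_type]
        simp only [← Finset.mul_sum, ← Finset.sum_mul]
        rw [sum_stdAddChar_mul, sum_stdAddChar_mul]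
        simp only [sub_eq_zero, Prod.ext_iff, @eq_comm _ p'.1, @eq_comm _ p'.2]
        by_cases h1 : p.1 = p'.1 <;> by_cases h2 : p.2 = p'.2 <;> simp [h1, h2, pow_two]
    _ = m ^ 2 * ∑ p, f p * (starRingEnd ℂ) (f p) := by
        simp [Finset.mul_sum, mul_comm]

theorem torusFourier_zero (f : ZMod m × ZMod m → ℂ) : torusFourier f 0 = ∑ p, f p := by
  simp [torusFourier]

theorem torusFourier_comp_shear (f : ZMod m × ZMod m → ℂ) :
    torusFourier (f ∘ torusStep id) = torusFourier f ∘ torusShear m := by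
  ext q
  simp only [torusFourier, Function.comp_apply]
  rw [← (torusStep (m := m) id).sum_comp (fun p => f p * _)]
  refine Finset.sum_congr rfl fun p _ => ?_
  simp only [torusStep, torusShear, Equiv.coe_fn_mk, id]
  ring_nf

theorem torusFourier_comp_swap (f : ZMod m × ZMod m → ℂ) :
    torusFourier (f ∘ torusStep fun _ => 0) =
      torusFourier f ∘ Equiv.prodComm (ZMod m) (ZMod m) := by
  ext q
  simp only [torusFourier, Function.comp_apply]
  rw [← (torusStep (m := m) fun _ => 0).sum_comp (fun p => f p * _)]
  refine Finset.sum_congr rfl fun p _ => ?_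
  simp only [torusStep, Equiv.prodComm_apply, Equiv.coe_fn_mk, Prod.fst_swap, Prod.snd_swap]
  ring_nf

theorem torusFourier_comp_translate (f : ZMod m × ZMod m → ℂ) (q : ZMod m × ZMod m) :
    torusFourier (f ∘ torusStep fun _ => 1) q = torusFourier f q.swap * ZMod.stdAddChar (-q.1) := by
  simp only [torusFourier, Function.comp_apply, Finset.sum_mul]
  rw [← (torusStep (m := m) fun _ => 1).sum_comp (fun p => f p * _ * _)]
  refine Finset.sum_congr rfl fun p _ => ?_
  simp only [torusStep, Equiv.coe_fn_mk, Prod.fst_swap, Prod.snd_swap]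
  rw [mul_assoc, ← AddChar.map_add_eq_mul]
  ring_nf

theorem two_le_norm_stdAddChar_sub_one_sq {a : ZMod m} (ha : (m : ℤ) ≤ 4 * |a.valMinAbs|) :
    2 ≤ ‖(ZMod.stdAddChar (-a) : ℂ) - 1‖ ^ 2 := by
  have hm : (0 : ℝ) < m := Nat.cast_pos.2 (NeZero.pos m)
  set j := a.valMinAbs with hj
  have h1 : 2 * |j| ≤ m := by
    have := a.valMinAbs_mem_Ioc
    rw [← hj] at this
    rcases abs_cases j with h | h <;> linarith [this.1, this.2]
  set θ : ℝ := 2 * Real.pi * |(j : ℝ)| / m with hθ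
  have hc : Real.cos θ ≤ 0 := by
    have ha' : (m : ℝ) ≤ 4 * |(j : ℝ)| := by exact_mod_cast ha
    have h1' : 2 * |(j : ℝ)| ≤ m := by exact_mod_cast h1
    apply Real.cos_nonpos_of_pi_div_two_le_of_le
    · rw [hθ, le_div_iff₀ hm]
      nlinarith [Real.pi_pos]
    · rw [hθ, div_le_iff₀ hm]
      nlinarith [Real.pi_pos]
  have e : (ZMod.stdAddChar (-a) : ℂ) = Complex.exp ((-(2 * Real.pi * j / m) : ℝ) * Complex.I) := by
    have : -a = ((-j : ℤ) : ZMod m) := by simp [hj]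
    rw [this, ZMod.stdAddChar_coe]
    congr 1
    push_cast
    ring
  have hcos : Real.cos (-(2 * Real.pi * j / m)) = Real.cos θ := by
    rw [Real.cos_neg, hθ]
    rcases abs_cases (j : ℝ) with h | h <;> rw [h.1]
    rw [show 2 * Real.pi * -(j : ℝ) / m = -(2 * Real.pi * j / m) by ring, Real.cos_neg]
  rw [e, Complex.sq_norm, Complex.normSq_apply]
  simp only [Complex.sub_re, Complex.sub_im, Complex.exp_ofReal_mul_I_re,
    Complex.exp_ofReal_mul_I_im, Complex.one_re, Complex.one_im, hcos]
  nlinarith [Real.sin_sq_add_cos_sq (-(2 * Real.pi * j / m))]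

theorem mass_torusFar_le (F : ZMod m × ZMod m → ℂ) {D : ℝ}
    (hs : l2norm (F ∘ Equiv.prodComm (ZMod m) (ZMod m) - F) ≤ D)
    (ht : l2norm ((fun q => F q.swap * ZMod.stdAddChar (-q.1)) - F) ≤ D) :
    mass F (torusFar m) ≤ 4 * D ^ 2 := by
  classical
  have hD : 0 ≤ D := (l2norm_nonneg _).trans hs
  have key : ∀ (g : ZMod m × ZMod m → ℂ) (c : ZMod m × ZMod m → ZMod m),
      (∀ q, g q = F q * (ZMod.stdAddChar (-c q) - 1)) → l2norm g ≤ 2 * D →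
      mass F (Finset.univ.filter fun q => (m : ℤ) ≤ 4 * |(c q).valMinAbs|) ≤ 2 * D ^ 2 := by
    intro g c hg hgD
    have h1 : ∑ q, ‖g q‖ ^ 2 ≤ 4 * D ^ 2 := by
      rw [← l2norm_sq]
      nlinarith [l2norm_nonneg g]
    have h2 : ∑ q ∈ Finset.univ.filter fun q => (m : ℤ) ≤ 4 * |(c q).valMinAbs|,
        2 * ‖F q‖ ^ 2 ≤ ∑ q, ‖g q‖ ^ 2 := by
      refine (Finset.sum_le_sum fun q hq => ?_).trans
        (Finset.sum_le_sum_of_subset_of_nonneg (Finset.subset_univ _) fun _ _ _ => sq_nonneg _)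
      rw [hg, norm_mul, mul_pow, mul_comm]
      exact mul_le_mul_of_nonneg_left
        (two_le_norm_stdAddChar_sub_one_sq (Finset.mem_filter.1 hq).2) (sq_nonneg _)
    rw [← Finset.mul_sum] at h2
    unfold mass
    linarith
  have h1 := key (fun q => F q * (ZMod.stdAddChar (-q.1) - 1)) Prod.fst (fun _ => rfl) (by
    have e : (fun q : ZMod m × ZMod m => F q * (ZMod.stdAddChar (-q.1) - 1)) =
        (fun q => (F q - F q.swap) * ZMod.stdAddChar (-q.1)) +
          ((fun q => F q.swap * ZMod.stdAddChar (-q.1)) - F) := by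
      ext q; simp only [Pi.add_apply, Pi.sub_apply]; ring
    rw [e]
    refine (l2norm_add_le _ _).trans ?_
    have : l2norm (fun q : ZMod m × ZMod m => (F q - F q.swap) * ZMod.stdAddChar (-q.1)) ≤ D := by
      refine l2norm_le_of_sq_le hD ?_
      have := pow_le_pow_left₀ (l2norm_nonneg _) hs 2
      rw [l2norm_sq] at this
      refine le_trans (le_of_eq ?_) this
      refine Finset.sum_congr rfl fun q _ => ?_
      rw [norm_mul, ZMod.stdAddChar_apply, Circle.norm_coe, mul_one, norm_sub_rev]
      rfl
    linarith)
  have h2 := key (fun q => F q * (ZMod.stdAddChar (-q.2) - 1)) Prod.snd (fun _ => rfl) (by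
    have e : (fun q : ZMod m × ZMod m => F q * (ZMod.stdAddChar (-q.2) - 1)) =
        (((fun q => F q.swap * ZMod.stdAddChar (-q.1)) - F) +
          (F - F ∘ Equiv.prodComm (ZMod m) (ZMod m))) ∘ Equiv.prodComm (ZMod m) (ZMod m) := by
      ext q; simp; ring
    rw [e, l2norm_comp_equiv]
    refine (l2norm_add_le _ _).trans ?_
    rw [l2norm_sub_comm] at hs
    linarith)
  have h3 : torusFar m = (Finset.univ.filter fun q => (m : ℤ) ≤ 4 * |q.1.valMinAbs|) ∪
      (Finset.univ.filter fun q => (m : ℤ) ≤ 4 * |q.2.valMinAbs|) := by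
    rw [torusFar, Finset.filter_or]
  rw [h3]
  have := mass_union_le F (Finset.univ.filter fun q => (m : ℤ) ≤ 4 * |q.1.valMinAbs|)
    (Finset.univ.filter fun q => (m : ℤ) ≤ 4 * |q.2.valMinAbs|)
  linarith

/-- The Poincaré inequality of the expander on the discrete torus whose edges are given by the
maps `(x, y) ↦ (y, x + y)`, `(x, y) ↦ (y, x)` and `(x, y) ↦ (y, x + 1)`. -/
theorem torus_poincare (f : ZMod m × ZMod m → ℂ) (hf : ∑ p, f p = 0) {D : ℝ}
    (h1 : l2norm (f ∘ torusStep id - f) ≤ D) (h2 : l2norm (f ∘ torusStep (fun _ => 0) - f) ≤ D)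
    (h3 : l2norm (f ∘ torusStep (fun _ => 1) - f) ≤ D) : l2norm f ≤ 70 * D := by
  have hm : (0 : ℝ) < m := Nat.cast_pos.2 (NeZero.pos m)
  have up : ∀ {g : ZMod m × ZMod m → ℂ}, l2norm (g - f) ≤ D →
      l2norm (torusFourier g - torusFourier f) ≤ m * D := by
    intro g hg
    rw [← torusFourier_sub, l2norm_torusFourier]
    exact mul_le_mul_of_nonneg_left hg hm.le
  have e1 := up h1
  have e2 := up h2
  have e3 := up h3
  rw [torusFourier_comp_shear] at e1
  rw [torusFourier_comp_swap] at e2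
  rw [funext (torusFourier_comp_translate f)] at e3
  have := l2norm_le_of_torus (torusFourier f) ((torusFourier_zero f).trans hf) e1 e2
    (mass_torusFar_le _ e2 e3)
  rw [l2norm_torusFourier] at this
  nlinarith

end Fourier

section HalfStep

variable {ι : Type*} [Fintype ι]

/-- The average of the identity and the composition with a permutation. -/
noncomputable def halfStep (T : ι ≃ ι) : Module.End ℂ (ι → ℂ) :=
  (2⁻¹ : ℂ) • (1 + LinearMap.funLeft ℂ ℂ T)

omit [Fintype ι] in
theorem halfStep_apply (T : ι ≃ ι) (f : ι → ℂ) : halfStep T f = (2⁻¹ : ℂ) • (f + f ∘ T) := rfl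

theorem l2norm_halfStep_sq (T : ι ≃ ι) (f : ι → ℂ) :
    l2norm (halfStep T f) ^ 2 = l2norm f ^ 2 - l2norm (f ∘ T - f) ^ 2 / 4 :=
  l2norm_half_add_sq _ _ (l2norm_comp_equiv T f)

theorem l2norm_halfStep_le (T : ι ≃ ι) (f : ι → ℂ) : l2norm (halfStep T f) ≤ l2norm f := by
  refine (pow_le_pow_iff_left₀ (l2norm_nonneg _) (l2norm_nonneg _) two_ne_zero).1 ?_
  rw [l2norm_halfStep_sq]
  linarith [sq_nonneg (l2norm (f ∘ T - f))]

theorem l2norm_halfStep_sub (T : ι ≃ ι) (f : ι → ℂ) :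
    l2norm (halfStep T f - f) = l2norm (f ∘ T - f) / 2 := by
  have : halfStep T f - f = (2⁻¹ : ℂ) • (f ∘ T - f) := by
    ext i
    simp [halfStep_apply]
    ring
  rw [this, l2norm_smul]
  norm_num
  ring

theorem l2norm_comp_sub_le (T : ι ≃ ι) (f g : ι → ℂ) :
    l2norm (f ∘ T - f) ≤ l2norm (g ∘ T - g) + 2 * l2norm (g - f) := by
  have h : f ∘ T - f = (f - g) ∘ T + ((g ∘ T - g) + (g - f)) := by
    ext i
    simp
  rw [h]
  refine (l2norm_add_le _ _).trans ?_
  rw [l2norm_comp_equiv, l2norm_sub_comm]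
  linarith [l2norm_add_le (g ∘ T - g) (g - f)]

theorem l2norm_halfStep_three_le (T₁ T₂ T₃ : ι ≃ ι) (f : ι → ℂ)
    (h : l2norm f ^ 2 ≤ 4900 * (l2norm (f ∘ T₁ - f) ^ 2 + l2norm (f ∘ T₂ - f) ^ 2 +
      l2norm (f ∘ T₃ - f) ^ 2)) :
    l2norm (halfStep T₁ (halfStep T₂ (halfStep T₃ f))) ≤ (1 - 1 / 235200) * l2norm f := by
  have s3 := l2norm_halfStep_sq T₃ f
  have d3 := l2norm_halfStep_sub T₃ f
  have n3 := l2norm_nonneg (f ∘ T₃ - f)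
  set g := halfStep T₃ f
  have s2 := l2norm_halfStep_sq T₂ g
  have d2 := l2norm_halfStep_sub T₂ g
  have n2 := l2norm_nonneg (g ∘ T₂ - g)
  have e2 := l2norm_comp_sub_le T₂ f g
  set k := halfStep T₂ g
  have s1 := l2norm_halfStep_sq T₁ k
  have n1 := l2norm_nonneg (k ∘ T₁ - k)
  have e1 := l2norm_comp_sub_le T₁ f k
  have e0 : l2norm (k - f) ≤ l2norm (k - g) + l2norm (g - f) := by
    simpa using l2norm_add_le (k - g) (g - f)
  rw [d3] at e2 e0
  rw [d2] at e0
  set x := l2norm (f ∘ T₃ - f)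
  set y := l2norm (g ∘ T₂ - g)
  set z := l2norm (k ∘ T₁ - k)
  have b2 : l2norm (f ∘ T₂ - f) ^ 2 ≤ 2 * (x ^ 2 + y ^ 2) := by
    have : l2norm (f ∘ T₂ - f) ≤ x + y := by linarith
    nlinarith [l2norm_nonneg (f ∘ T₂ - f), sq_nonneg (x - y)]
  have b1 : l2norm (f ∘ T₁ - f) ^ 2 ≤ 3 * (x ^ 2 + y ^ 2 + z ^ 2) := by
    have : l2norm (f ∘ T₁ - f) ≤ x + y + z := by linarith
    nlinarith [l2norm_nonneg (f ∘ T₁ - f), sq_nonneg (x - y), sq_nonneg (x - z),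
      sq_nonneg (y - z)]
  have n := l2norm_nonneg f
  refine (pow_le_pow_iff_left₀ (l2norm_nonneg _) (by positivity) two_ne_zero).1 ?_
  rw [s1, s2, s3, mul_pow]
  nlinarith [sq_nonneg x, sq_nonneg y, sq_nonneg z, sq_nonneg (l2norm f)]

end HalfStep

section Walk

variable {V G : Type*} [Fintype V] [Fintype G]

/-- The average of a function of two variables over the first one. -/
noncomputable def fiberAvg (Φ : V × G → ℂ) : G → ℂ :=
  fun x => (Fintype.card V : ℂ)⁻¹ * ∑ v, Φ (v, x)

/-- A function of the second variable as a function of two variables. -/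
def constLift (V : Type*) {G : Type*} (f : G → ℂ) : V × G → ℂ := fun p => f p.2

theorem l2norm_sq_eq_sum_slice (Φ : V × G → ℂ) :
    l2norm Φ ^ 2 = ∑ x, l2norm (fun v => Φ (v, x)) ^ 2 := by
  simp only [l2norm_sq, Fintype.sum_prod_type_right]

theorem l2norm_constLift_sq (f : G → ℂ) :
    l2norm (constLift V f) ^ 2 = Fintype.card V * l2norm f ^ 2 := by
  rw [l2norm_sq, l2norm_sq, Fintype.sum_prod_type]
  simp [constLift]

theorem l2norm_le_of_constLift_le [Nonempty V] {f g : G → ℂ} {c : ℝ}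
    (hc : 0 ≤ c) (h : l2norm (constLift V f) ≤ c * l2norm (constLift V g)) :
    l2norm f ≤ c * l2norm g := by
  have hn : (0 : ℝ) < Fintype.card V := Nat.cast_pos.2 Fintype.card_pos
  have h2 := pow_le_pow_left₀ (l2norm_nonneg _) h 2
  rw [mul_pow, l2norm_constLift_sq, l2norm_constLift_sq] at h2
  refine (pow_le_pow_iff_left₀ (l2norm_nonneg _) (mul_nonneg hc (l2norm_nonneg _)) two_ne_zero).1 ?_
  rw [mul_pow]
  refine le_of_mul_le_mul_left ?_ hn
  linarith

theorem l2norm_constLift_le_of_le {f g : G → ℂ} {c : ℝ}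
    (hc : 0 ≤ c) (h : l2norm f ≤ c * l2norm g) :
    l2norm (constLift V f) ≤ c * l2norm (constLift V g) := by
  have h2 := pow_le_pow_left₀ (l2norm_nonneg _) h 2
  refine (pow_le_pow_iff_left₀ (l2norm_nonneg _) (mul_nonneg hc (l2norm_nonneg _)) two_ne_zero).1 ?_
  rw [mul_pow, l2norm_constLift_sq, l2norm_constLift_sq]
  rw [mul_pow] at h2
  have := mul_le_mul_of_nonneg_left h2 (Nat.cast_nonneg (α := ℝ) (Fintype.card V))
  linarith

omit [Fintype G] in
theorem fiberAvg_constLift [Nonempty V] (f : G → ℂ) : fiberAvg (constLift V f) = f := by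
  ext x
  simp [fiberAvg, constLift]

omit [Fintype G] in
theorem fiberAvg_sub (Φ Ψ : V × G → ℂ) : fiberAvg (Φ - Ψ) = fiberAvg Φ - fiberAvg Ψ := by
  ext x
  simp [fiberAvg, mul_sub]

theorem l2norm_constLift_fiberAvg_le [Nonempty V] (Φ : V × G → ℂ) :
    l2norm (constLift V (fiberAvg Φ)) ≤ l2norm Φ := by
  have hn : (0 : ℝ) < Fintype.card V := Nat.cast_pos.2 Fintype.card_pos
  refine (pow_le_pow_iff_left₀ (l2norm_nonneg _) (l2norm_nonneg _) two_ne_zero).1 ?_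
  rw [l2norm_constLift_sq, l2norm_sq, l2norm_sq, Fintype.sum_prod_type_right, Finset.mul_sum]
  refine Finset.sum_le_sum fun x _ => ?_
  have h1 : ‖∑ v, Φ (v, x)‖ ^ 2 ≤ Fintype.card V * ∑ v, ‖Φ (v, x)‖ ^ 2 :=
    (pow_le_pow_left₀ (norm_nonneg _) (norm_sum_le _ _) 2).trans sq_sum_le_card_mul_sum_sq
  rw [fiberAvg, norm_mul, norm_inv, Complex.norm_natCast, mul_pow]
  calc (Fintype.card V : ℝ) * ((Fintype.card V : ℝ)⁻¹ ^ 2 * ‖∑ v, Φ (v, x)‖ ^ 2)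
      ≤ (Fintype.card V : ℝ) * ((Fintype.card V : ℝ)⁻¹ ^ 2 *
          (Fintype.card V * ∑ v, ‖Φ (v, x)‖ ^ 2)) := by gcongr
    _ = ∑ v, ‖Φ (v, x)‖ ^ 2 := by field_simp

/-- An operator on functions of two variables that acts on the first variable, where it is a
contraction that preserves constants and averages and contracts by the factor `μ` on the functions
of average zero. -/
structure IsMixing (μ : ℝ) (B : Module.End ℂ (V × G → ℂ)) : Prop where
  map_constLift : ∀ f, B (constLift V f) = constLift V f
  fiberAvg_map : ∀ Φ, fiberAvg (B Φ) = fiberAvg Φ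
  norm_le : ∀ Φ, l2norm (B Φ) ≤ l2norm Φ
  contract : ∀ Φ, fiberAvg Φ = 0 → l2norm (B Φ) ≤ μ * l2norm Φ
  slice_mem : ∀ (W : Submodule ℂ (G → ℂ)) Φ, (∀ v, (fun x => Φ (v, x)) ∈ W) →
    ∀ v, (fun x => B Φ (v, x)) ∈ W

theorem IsMixing.pow {μ : ℝ} (hμ : 0 ≤ μ) {B : Module.End ℂ (V × G → ℂ)} (h : IsMixing μ B)
    (r : ℕ) : IsMixing (μ ^ r) (B ^ r) := by
  induction r with
  | zero => exact ⟨fun _ => rfl, fun _ => rfl, fun _ => le_rfl, fun _ _ => by simp, fun _ _ h => h⟩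
  | succ r ih =>
    refine ⟨fun f => ?_, fun Φ => ?_, fun Φ => ?_, fun Φ hΦ => ?_, fun W Φ hΦ => ?_⟩
    · rw [pow_succ, Module.End.mul_apply, h.map_constLift, ih.map_constLift]
    · rw [pow_succ, Module.End.mul_apply, ih.fiberAvg_map, h.fiberAvg_map]
    · rw [pow_succ, Module.End.mul_apply]
      exact (ih.norm_le _).trans (h.norm_le _)
    · rw [pow_succ, Module.End.mul_apply, pow_succ, mul_assoc]
      exact (ih.contract _ ((h.fiberAvg_map _).trans hΦ)).trans
        (mul_le_mul_of_nonneg_left (h.contract _ hΦ) (pow_nonneg hμ r))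
    · rw [pow_succ, Module.End.mul_apply]
      exact ih.slice_mem W _ (h.slice_mem W Φ hΦ)

theorem IsMixing.norm_map_sub_le [Nonempty V] {μ : ℝ} (hμ : 0 ≤ μ)
    {B : Module.End ℂ (V × G → ℂ)} (h : IsMixing μ B) (Φ : V × G → ℂ) :
    l2norm (B (Φ - constLift V (fiberAvg Φ))) ≤ 2 * μ * l2norm Φ := by
  refine (h.contract _ (by rw [fiberAvg_sub, fiberAvg_constLift, sub_self])).trans ?_
  have h1 : l2norm (Φ - constLift V (fiberAvg Φ)) ≤ 2 * l2norm Φ := by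
    rw [sub_eq_add_neg]
    refine (l2norm_add_le _ _).trans ?_
    have : l2norm (-constLift V (fiberAvg Φ)) = l2norm (constLift V (fiberAvg Φ)) := by
      simpa using l2norm_smul (-1) (constLift V (fiberAvg Φ))
    linarith [l2norm_constLift_fiberAvg_le Φ]
  calc μ * l2norm (Φ - constLift V (fiberAvg Φ)) ≤ μ * (2 * l2norm Φ) := by gcongr
    _ = _ := by ring

variable [Group G]

omit [Fintype V] [Fintype G] in
/-- The translation of the second variable by an element that depends on the first one. -/
def twistEquiv (a : V → G) : V × G ≃ V × G where
  toFun p := (p.1, p.2 * a p.1)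
  invFun p := (p.1, p.2 * (a p.1)⁻¹)
  left_inv p := by simp
  right_inv p := by simp

omit [Fintype V] [Fintype G] in
/-- Composition with `twistEquiv a`. -/
def twist (a : V → G) : Module.End ℂ (V × G → ℂ) := LinearMap.funLeft ℂ ℂ (twistEquiv a)

theorem l2norm_twist (a : V → G) (Φ : V × G → ℂ) : l2norm (twist a Φ) = l2norm Φ :=
  l2norm_comp_equiv (twistEquiv a) Φ

/-- The values of `a` act on the functions in `W` with average of norm at most `lam`. -/
def AvgContracts (W : Submodule ℂ (G → ℂ)) (lam : ℝ) (a : V → G) : Prop :=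
  ∀ f ∈ W, l2norm (fiberAvg (twist a (constLift V f))) ≤ lam * l2norm f

omit [Fintype V] [Fintype G] in
theorem twist_slice_mem {W : Submodule ℂ (G → ℂ)} (hW : ∀ f ∈ W, ∀ g, (fun x => f (x * g)) ∈ W)
    (a : V → G) (Φ : V × G → ℂ) (hΦ : ∀ v, (fun x => Φ (v, x)) ∈ W) (v : V) :
    (fun x => twist a Φ (v, x)) ∈ W :=
  hW _ (hΦ v) (a v)

omit [Fintype G] [Group G] in
theorem fiberAvg_mem {W : Submodule ℂ (G → ℂ)} (Φ : V × G → ℂ)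
    (hΦ : ∀ v, (fun x => Φ (v, x)) ∈ W) : fiberAvg Φ ∈ W := by
  have : fiberAvg Φ = (Fintype.card V : ℂ)⁻¹ • ∑ v, fun x => Φ (v, x) := by
    ext x
    simp [fiberAvg]
  rw [this]
  exact W.smul_mem _ (W.sum_mem fun v _ => hΦ v)

theorem IsMixing.twist_le [Nonempty V] {μ lam : ℝ} (hμ : 0 ≤ μ) (hl : 0 ≤ lam)
    {B : Module.End ℂ (V × G → ℂ)}
    (h : IsMixing μ B) {W : Submodule ℂ (G → ℂ)} {a : V → G} (ha : AvgContracts W lam a)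
    (Φ : V × G → ℂ) (hΦ : ∀ v, (fun x => Φ (v, x)) ∈ W) :
    l2norm (B (twist a (B Φ))) ≤ (lam + 4 * μ) * l2norm Φ := by
  set f := fiberAvg Φ with hf
  have hfW : f ∈ W := fiberAvg_mem Φ hΦ
  set Ψ := twist a (constLift V f) with hΨ
  have e1 : B (twist a (B Φ)) = constLift V (fiberAvg Ψ) + B (Ψ - constLift V (fiberAvg Ψ)) +
      B (twist a (B (Φ - constLift V f))) := by
    simp only [map_sub, h.map_constLift, ← hΨ]
    abel
  have n1 := l2norm_constLift_le_of_le (V := V) hl (ha f hfW)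
  have n2 := h.norm_map_sub_le hμ Ψ
  have n3 : l2norm (B (twist a (B (Φ - constLift V f)))) ≤ 2 * μ * l2norm Φ := by
    refine (h.norm_le _).trans ?_
    rw [l2norm_twist]
    exact h.norm_map_sub_le hμ Φ
  have n4 := l2norm_constLift_fiberAvg_le Φ
  rw [← hf] at n4
  rw [hΨ, l2norm_twist, ← hΨ] at n2
  have n5 := mul_le_mul_of_nonneg_left n4 hl
  have n6 := mul_le_mul_of_nonneg_left n4 hμ
  rw [e1]
  refine (l2norm_add_le _ _).trans ?_
  have := l2norm_add_le (constLift V (fiberAvg Ψ)) (B (Ψ - constLift V (fiberAvg Ψ)))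
  linarith

/-- The alternating product of two families along a walk of a mixing operator contracts `W` if one
of the families does. -/
theorem IsMixing.walk_le [Nonempty V] {μ lam : ℝ} (hμ : 0 ≤ μ) (hl : 0 ≤ lam)
    (hlm : lam + 4 * μ ≤ 1 / 2) {B : Module.End ℂ (V × G → ℂ)} (h : IsMixing μ B)
    {W : Submodule ℂ (G → ℂ)} (hW : ∀ f ∈ W, ∀ g, (fun x => f (x * g)) ∈ W) {a b : V → G}
    (hab : AvgContracts W lam a ∨ AvgContracts W lam b) {f : G → ℂ} (hf : f ∈ W) :
    l2norm (fiberAvg (twist a (B (twist b (B (twist a (B (twist b (constLift V f))))))))) ≤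
      1 / 4 * l2norm f := by
  refine l2norm_le_of_constLift_le (V := V) (by norm_num) ?_
  have hf0 : ∀ v : V, (fun x => constLift V f (v, x)) ∈ W := fun _ => hf
  have half : ∀ {c : V → G}, AvgContracts W lam c → ∀ Φ : V × G → ℂ,
      (∀ v, (fun x => Φ (v, x)) ∈ W) → l2norm (B (twist c (B Φ))) ≤ 1 / 2 * l2norm Φ := by
    intro c hc Φ hΦ
    exact (h.twist_le hμ hl hc Φ hΦ).trans (mul_le_mul_of_nonneg_right hlm (l2norm_nonneg _))
  have tw : ∀ (c : V → G) (Φ : V × G → ℂ), (∀ v, (fun x => Φ (v, x)) ∈ W) →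
      ∀ v, (fun x => twist c Φ (v, x)) ∈ W := fun c Φ => twist_slice_mem hW c Φ
  rcases hab with ha | hb
  · rw [← h.fiberAvg_map]
    refine (l2norm_constLift_fiberAvg_le _).trans ?_
    have h1 := tw b _ hf0
    have h2 := tw b _ (h.slice_mem W _ (tw a _ (h.slice_mem W _ h1)))
    have n1 := half ha _ h1
    have n2 := half ha _ h2
    rw [l2norm_twist] at n1 n2
    linarith
  · refine (l2norm_constLift_fiberAvg_le _).trans ?_
    rw [l2norm_twist]
    have h2 := tw a _ (h.slice_mem W _ (tw b _ (h.slice_mem W _ hf0)))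
    have n1 := half hb _ hf0
    have n2 := half hb _ h2
    rw [l2norm_twist] at n2
    rw [h.map_constLift] at n1 n2
    linarith

end Walk

section TorusWalk

variable {m : ℕ} {G : Type*}

/-- The half step of a permutation of the first variable. -/
noncomputable def fstHalfStep {V : Type*} (G : Type*) (T : V ≃ V) : Module.End ℂ (V × G → ℂ) :=
  halfStep (T.prodCongr (Equiv.refl G))

theorem fstHalfStep_apply {V : Type*} (T : V ≃ V) (Φ : V × G → ℂ) (p : V × G) :
    fstHalfStep G T Φ p = 2⁻¹ * (Φ p + Φ (T p.1, p.2)) := rfl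

theorem fstHalfStep_constLift {V : Type*} (T : V ≃ V) (f : G → ℂ) :
    fstHalfStep G T (constLift V f) = constLift V f := by
  ext p
  simp only [fstHalfStep_apply, constLift]
  ring

theorem fiberAvg_fstHalfStep {V : Type*} [Fintype V] (T : V ≃ V) (Φ : V × G → ℂ) :
    fiberAvg (fstHalfStep G T Φ) = fiberAvg Φ := by
  ext x
  simp only [fiberAvg, fstHalfStep_apply, ← Finset.mul_sum, Finset.sum_add_distrib]
  rw [T.sum_comp fun v => Φ (v, x)]
  ring

theorem fstHalfStep_slice_mem {V : Type*} (T : V ≃ V) {W : Submodule ℂ (G → ℂ)} (Φ : V × G → ℂ)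
    (hΦ : ∀ v, (fun x => Φ (v, x)) ∈ W) (v : V) : (fun x => fstHalfStep G T Φ (v, x)) ∈ W := by
  simp only [fstHalfStep_apply]
  exact W.smul_mem (2⁻¹ : ℂ) (W.add_mem (hΦ v) (hΦ (T v)))

/-- The product of the half steps of the three permutations of the torus. -/
noncomputable def torusMix (m : ℕ) (G : Type*) : Module.End ℂ ((ZMod m × ZMod m) × G → ℂ) :=
  fstHalfStep G (torusStep id) * fstHalfStep G (torusStep fun _ => 0) *
    fstHalfStep G (torusStep fun _ => 1)

theorem torusMix_apply (Φ : (ZMod m × ZMod m) × G → ℂ) : torusMix m G Φ =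
    fstHalfStep G (torusStep id) (fstHalfStep G (torusStep fun _ => 0)
      (fstHalfStep G (torusStep fun _ => 1) Φ)) := rfl

theorem isMixing_torusMix [NeZero m] [Fintype G] :
    IsMixing (1 - 1 / 235200) (torusMix m G) where
  map_constLift f := by simp only [torusMix_apply, fstHalfStep_constLift]
  fiberAvg_map Φ := by simp only [torusMix_apply, fiberAvg_fstHalfStep]
  norm_le Φ := by
    rw [torusMix_apply]
    exact (l2norm_halfStep_le _ _).trans ((l2norm_halfStep_le _ _).trans (l2norm_halfStep_le _ _))
  slice_mem W Φ h := by
    simp only [torusMix_apply]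
    exact fstHalfStep_slice_mem _ _ (fstHalfStep_slice_mem _ _ (fstHalfStep_slice_mem _ _ h))
  contract Φ hΦ := by
    rw [torusMix_apply]
    refine l2norm_halfStep_three_le _ _ _ Φ ?_
    simp only [l2norm_sq_eq_sum_slice (V := ZMod m × ZMod m), ← Finset.sum_add_distrib,
      Finset.mul_sum]
    refine Finset.sum_le_sum fun x _ => ?_
    have hx : ∑ v, Φ (v, x) = 0 := by
      have := congrFun hΦ x
      simpa [fiberAvg, NeZero.ne m] using this
    set f : ZMod m × ZMod m → ℂ := fun v => Φ (v, x) with hf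
    set d1 := l2norm (f ∘ torusStep id - f) with hd1
    set d2 := l2norm (f ∘ torusStep (fun _ => 0) - f) with hd2
    set d3 := l2norm (f ∘ torusStep (fun _ => 1) - f) with hd3
    have n1 : 0 ≤ d1 := l2norm_nonneg _
    have n2 : 0 ≤ d2 := l2norm_nonneg _
    have n3 : 0 ≤ d3 := l2norm_nonneg _
    have key : l2norm f ≤ 70 * Real.sqrt (d1 ^ 2 + d2 ^ 2 + d3 ^ 2) :=
      torus_poincare f hx (Real.le_sqrt_of_sq_le (by nlinarith))
        (Real.le_sqrt_of_sq_le (by nlinarith)) (Real.le_sqrt_of_sq_le (by nlinarith))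
    have key2 := pow_le_pow_left₀ (l2norm_nonneg _) key 2
    rw [mul_pow, Real.sq_sqrt (by positivity)] at key2
    refine key2.trans (le_of_eq ?_)
    norm_num
    rfl

end TorusWalk

section RightAvg

variable {G : Type*} [Group G]

/-- The average of the right translates of `f` by the entries of a list. -/
noncomputable def rightAvg (S : List G) (f : G → ℂ) : G → ℂ :=
  fun x => (S.length : ℂ)⁻¹ * (S.map fun s => f (x * s)).sum

theorem rightAvg_eq_smul_sum (S : List G) (f : G → ℂ) :
    rightAvg S f = (S.length : ℂ)⁻¹ • (S.map fun s => fun x => f (x * s)).sum := by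
  have key : ∀ x, (S.map fun s => f (x * s)).sum = (S.map fun s => fun x => f (x * s)).sum x := by
    intro x
    induction S with
    | nil => rfl
    | cons s S ih => simp [ih]
  ext x
  rw [rightAvg, key, Pi.smul_apply, smul_eq_mul]

theorem rightAvg_mem {W : Submodule ℂ (G → ℂ)} (hW : ∀ f ∈ W, ∀ g, (fun x => f (x * g)) ∈ W)
    (S : List G) {f : G → ℂ} (hf : f ∈ W) : rightAvg S f ∈ W := by
  rw [rightAvg_eq_smul_sum]
  refine W.smul_mem _ (list_sum_mem fun g hg => ?_)
  obtain ⟨s, _, rfl⟩ := List.mem_map.1 hg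
  exact hW f hf s

theorem rightAvg_add (S : List G) (f g : G → ℂ) :
    rightAvg S (f + g) = rightAvg S f + rightAvg S g := by
  ext x
  simp [rightAvg, List.sum_map_add, mul_add]

theorem cayleyOp_append_inv (S : List G) (f : G → ℂ) :
    cayleyOp ((S ++ S.map fun s => s⁻¹ : List G) : Multiset G) f =
      (2⁻¹ : ℂ) • (rightAvg S f + rightAvg (S.map fun s => s⁻¹) f) := by
  ext x
  simp only [cayleyOp, rightAvg, Multiset.map_coe, Multiset.sum_coe, Multiset.coe_card,
    List.length_append, List.length_map, List.map_append, List.sum_append, List.map_map,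
    List.sum_map_add, Function.comp_def, inv_inv, Pi.smul_apply, Pi.add_apply, smul_eq_mul]
  push_cast
  rw [mul_inv, ← two_mul (S.length : ℂ), mul_inv]
  ring

theorem isInverseClosed_append_inv (S : List G) :
    IsInverseClosed ((S ++ S.map fun s => s⁻¹ : List G) : Multiset G) := by
  rw [IsInverseClosed, ← Multiset.coe_add, Multiset.map_add, ← Multiset.map_coe, Multiset.map_map,
    add_comm]
  simp

variable [Fintype G]

theorem sum_rightAvg_mul_conj (S : List G) (f g : G → ℂ) :
    ∑ x, rightAvg S f x * (starRingEnd ℂ) (g x) =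
      ∑ x, f x * (starRingEnd ℂ) (rightAvg (S.map fun s => s⁻¹) g x) := by
  simp only [rightAvg, List.length_map, List.map_map, Function.comp_def, map_mul, map_inv₀,
    Complex.conj_natCast, mul_assoc, mul_left_comm _ (S.length : ℂ)⁻¹, ← Finset.mul_sum]
  congr 1
  induction S with
  | nil => simp
  | cons s S ih =>
    simp only [List.map_cons, List.sum_cons, add_mul, mul_add, map_add, Finset.sum_add_distrib]
    rw [ih]
    congr 1
    rw [← Equiv.sum_comp (Equiv.mulRight s) fun x => f x * (starRingEnd ℂ) (g (x * s⁻¹))]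
    simp

theorem sum_rightAvg_eq_zero (S : List G) {f : G → ℂ} (hf : ∑ x, f x = 0) :
    ∑ x, rightAvg S f x = 0 := by
  have h := sum_rightAvg_mul_conj S f 1
  simp only [Pi.one_apply, map_one, mul_one] at h
  have : ∀ x, rightAvg (S.map fun s => s⁻¹) (1 : G → ℂ) x = (S.length : ℂ)⁻¹ * S.length := by
    intro x
    simp [rightAvg, Function.comp_def]
  rw [h]
  simp only [this, ← Finset.sum_mul, hf, zero_mul]

theorem l2norm_rightAvg_inv_le {c : ℝ} {S : List G}
    (h : ∀ f : G → ℂ, ∑ x, f x = 0 → l2norm (rightAvg S f) ≤ c * l2norm f) {f : G → ℂ}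
    (hf : ∑ x, f x = 0) (hc : 0 ≤ c) :
    l2norm (rightAvg (S.map fun s => s⁻¹) f) ≤ c * l2norm f := by
  set g := rightAvg (S.map fun s => s⁻¹) f with hg
  have hg0 : ∑ x, g x = 0 := sum_rightAvg_eq_zero _ hf
  have e : l2norm g ^ 2 ≤ c * l2norm g * l2norm f := by
    have h1 : ((l2norm g ^ 2 : ℝ) : ℂ) = ∑ x, rightAvg S g x * (starRingEnd ℂ) (f x) := by
      rw [sum_rightAvg_mul_conj, l2norm_sq]
      push_cast
      simp only [← Complex.mul_conj', ← hg]
    calc l2norm g ^ 2 = ‖((l2norm g ^ 2 : ℝ) : ℂ)‖ := by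
          rw [Complex.norm_real, Real.norm_of_nonneg (sq_nonneg _)]
      _ ≤ ∑ x, ‖rightAvg S g x‖ * ‖f x‖ := by
          rw [h1]
          refine (norm_sum_le _ _).trans (le_of_eq ?_)
          simp
      _ ≤ l2norm (rightAvg S g) * l2norm f := sum_norm_mul_le _ _
      _ ≤ c * l2norm g * l2norm f := mul_le_mul_of_nonneg_right (h g hg0) (l2norm_nonneg _)
  rcases (l2norm_nonneg g).eq_or_lt with h0 | h0
  · rw [← h0]; exact mul_nonneg hc (l2norm_nonneg _)
  · refine le_of_mul_le_mul_left ?_ h0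
    linarith

theorem closure_eq_top_of_isSpectralExpander {S : List G} (hS : S ≠ [])
    (h : IsSpectralExpander (1 / 4) (S : Multiset G)) :
    Subgroup.closure {g : G | g ∈ (S : Multiset G)} = ⊤ := by
  classical
  set H := Subgroup.closure {g : G | g ∈ (S : Multiset G)} with hH
  set u : G → ℂ := fun x => if x ∈ H then 1 else 0 with hu
  set c : ℂ := (Fintype.card G : ℂ)⁻¹ * ∑ x, u x with hc
  set f : G → ℂ := fun x => u x - c with hf
  have hf0 : ∑ x, f x = 0 := by
    simp [hf, hc, Finset.sum_sub_distrib]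
  have inv : ∀ s ∈ S, ∀ x, f (x * s) = f x ∧ f (x * s⁻¹) = f x := by
    intro s hs x
    have hsH : s ∈ H := Subgroup.subset_closure (by simpa using hs)
    simp only [hf, hu, H.mul_mem_cancel_right hsH, H.mul_mem_cancel_right (H.inv_mem hsH), and_self]
  have op : cayleyOp (S : Multiset G) f = f := by
    ext x
    have : S.map (fun s => f (x * s) + f (x * s⁻¹)) = S.map fun _ => 2 * f x := by
      refine List.map_congr_left fun s hs => ?_
      rw [(inv s hs x).1, (inv s hs x).2]; ring
    have hl : (S.length : ℂ) ≠ 0 := by simpa using hS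
    simp only [cayleyOp, Multiset.map_coe, Multiset.sum_coe, Multiset.coe_card, this]
    simp
    field_simp
  have hn : l2norm f ≤ 1 / 4 * l2norm f := by
    have := h f hf0
    rwa [op] at this
  have hz : f = 0 := l2norm_eq_zero.1 (by linarith [l2norm_nonneg f])
  have h1 : u 1 = c := sub_eq_zero.1 (congrFun hz 1)
  rw [eq_top_iff]
  intro x _
  have hx : u x = c := sub_eq_zero.1 (congrFun hz x)
  by_contra hxH
  rw [← h1] at hx
  simp [hu, hxH] at hx

theorem isExpandingGenerating_append_inv {S : List G} (hS : S ≠ [])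
    (h : ∀ f : G → ℂ, ∑ x, f x = 0 → l2norm (rightAvg S f) ≤ 1 / 4 * l2norm f) :
    IsExpandingGenerating (1 / 4) ((S ++ S.map fun s => s⁻¹ : List G) : Multiset G) := by
  have hs : IsSpectralExpander (1 / 4) ((S ++ S.map fun s => s⁻¹ : List G) : Multiset G) := by
    intro f hf
    change l2norm (cayleyOp _ f) ≤ 1 / 4 * l2norm f
    rw [cayleyOp_append_inv, l2norm_smul]
    have h1 := h f hf
    have h2 := l2norm_rightAvg_inv_le h hf (by norm_num)
    have h3 := l2norm_add_le (rightAvg S f) (rightAvg (S.map fun s => s⁻¹) f)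
    norm_num at h1 h2 h3 ⊢
    linarith
  exact ⟨closure_eq_top_of_isSpectralExpander (by simp [hS]) hs, hs⟩

end RightAvg

section NormalSubgroup

variable {G : Type*} [Group G] (N : Subgroup G)

/-- The functions whose sums over the cosets of `N` vanish. -/
def cosetSumZero [N.Normal] [Fintype N] : Submodule ℂ (G → ℂ) where
  carrier := {f | ∀ x, ∑ n : N, f (x * n) = 0}
  zero_mem' := fun x => by simp
  add_mem' := fun {f g} hf hg x => by simp [Finset.sum_add_distrib, hf x, hg x]
  smul_mem' := fun c f hf x => by simp [← Finset.mul_sum, hf x]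

/-- The functions of sum zero that are constant on the cosets of `N`. -/
def cosetConstant [Fintype G] : Submodule ℂ (G → ℂ) where
  carrier := {f | (∀ x, ∀ n ∈ N, f (x * n) = f x) ∧ ∑ x, f x = 0}
  zero_mem' := ⟨fun _ _ _ => rfl, by simp⟩
  add_mem' := fun {f g} hf hg =>
    ⟨fun x n hn => by simp [hf.1 x n hn, hg.1 x n hn], by simp [Finset.sum_add_distrib, hf.2, hg.2]⟩
  smul_mem' := fun c f hf =>
    ⟨fun x n hn => by simp [hf.1 x n hn], by simp [← Finset.mul_sum, hf.2]⟩

variable [hN : N.Normal]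

theorem cosetSumZero_translate [Fintype N] (f : G → ℂ) (hf : f ∈ cosetSumZero N) (g : G) :
    (fun x => f (x * g)) ∈ cosetSumZero N := by
  intro x
  have h := hf (x * g)
  rw [← (MulAut.conjNormal (H := N) g⁻¹).toEquiv.sum_comp] at h
  rw [← h]
  refine Finset.sum_congr rfl fun n _ => ?_
  simp [mul_assoc]

theorem cosetConstant_translate [Fintype G] (f : G → ℂ) (hf : f ∈ cosetConstant N) (g : G) :
    (fun x => f (x * g)) ∈ cosetConstant N := by
  refine ⟨fun x n hn => ?_, ?_⟩
  · have := hf.1 (x * g) (g⁻¹ * n * g) (by simpa using hN.conj_mem n hn g⁻¹)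
    simpa [mul_assoc] using this
  · rw [← hf.2]
    exact Equiv.sum_comp (Equiv.mulRight g) f

variable [Fintype G] [Fintype N]

omit hN in
theorem sum_sum_mul_coset {M : Type*} [AddCommMonoid M] (F : G → M) :
    ∑ x, ∑ n : N, F (x * n) = Fintype.card N • ∑ x, F x := by
  rw [Finset.sum_comm]
  have : ∀ n : N, ∑ x, F (x * n) = ∑ x, F x := fun n => Equiv.sum_comp (Equiv.mulRight (n : G)) F
  simp [this]

theorem l2norm_add_sq_of_coset {f g : G → ℂ} (hf : f ∈ cosetConstant N)
    (hg : g ∈ cosetSumZero N) : l2norm (f + g) ^ 2 = l2norm f ^ 2 + l2norm g ^ 2 := by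
  have h0 : ∑ x, f x * (starRingEnd ℂ) (g x) = 0 := by
    have h1 := sum_sum_mul_coset N fun x => f x * (starRingEnd ℂ) (g x)
    have h2 : ∀ x, ∑ n : N, f (x * n) * (starRingEnd ℂ) (g (x * n)) = 0 := by
      intro x
      have : ∀ n : N, f (x * n) = f x := fun n => hf.1 x n n.2
      simp only [this, ← Finset.mul_sum, ← map_sum, hg x, map_zero, mul_zero]
    simpa [h2] using h1.symm
  have h3 : ∑ x, (f x * (starRingEnd ℂ) (g x)).re = 0 := by
    rw [← Complex.re_sum, h0, Complex.zero_re]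
  rw [l2norm_sq, l2norm_sq, l2norm_sq, ← Finset.sum_add_distrib]
  rw [← add_zero (∑ x, (‖f x‖ ^ 2 + ‖g x‖ ^ 2)), ← mul_zero 2, ← h3, Finset.mul_sum,
    ← Finset.sum_add_distrib]
  refine Finset.sum_congr rfl fun x _ => ?_
  simp only [Pi.add_apply, Complex.sq_norm, Complex.normSq_add]

theorem exists_coset_decomposition {f : G → ℂ} (hf : ∑ x, f x = 0) :
    ∃ f₀ ∈ cosetConstant N, ∃ f₁ ∈ cosetSumZero N, f = f₀ + f₁ := by
  set f₀ : G → ℂ := fun x => (Fintype.card N : ℂ)⁻¹ * ∑ n : N, f (x * n) with hf₀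
  have h1 : ∀ x, ∀ n ∈ N, f₀ (x * n) = f₀ x := by
    intro x n hn
    simp only [hf₀]
    rw [← Equiv.sum_comp (Equiv.mulLeft (⟨n, hn⟩ : N)) fun k : N => f (x * k)]
    simp [mul_assoc]
  refine ⟨f₀, ⟨h1, ?_⟩, f - f₀, fun x => ?_, by simp⟩
  · simp only [hf₀, ← Finset.mul_sum, sum_sum_mul_coset N f, hf, smul_zero, mul_zero]
  · have : ∀ n : N, f₀ (x * n) = f₀ x := fun n => h1 x n n.2
    simp only [Pi.sub_apply, Finset.sum_sub_distrib, this]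
    simp [hf₀]

/-- An average of right translations that contracts both the functions that are constant on the
cosets and those with vanishing coset sums contracts all functions of sum zero. -/
theorem l2norm_rightAvg_le_of_coset {S : List G} {c : ℝ} (hc : 0 ≤ c)
    (h₀ : ∀ f ∈ cosetConstant N, l2norm (rightAvg S f) ≤ c * l2norm f)
    (h₁ : ∀ f ∈ cosetSumZero N, l2norm (rightAvg S f) ≤ c * l2norm f) {f : G → ℂ}
    (hf : ∑ x, f x = 0) : l2norm (rightAvg S f) ≤ c * l2norm f := by
  obtain ⟨f₀, hf₀, f₁, hf₁, rfl⟩ := exists_coset_decomposition N hf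
  refine (pow_le_pow_iff_left₀ (l2norm_nonneg _) (mul_nonneg hc (l2norm_nonneg _)) two_ne_zero).1 ?_
  rw [mul_pow, rightAvg_add, l2norm_add_sq_of_coset N hf₀ hf₁,
    l2norm_add_sq_of_coset N (rightAvg_mem (cosetConstant_translate N) S hf₀)
      (rightAvg_mem (cosetSumZero_translate N) S hf₁)]
  have a := pow_le_pow_left₀ (l2norm_nonneg _) (h₀ f₀ hf₀) 2
  have b := pow_le_pow_left₀ (l2norm_nonneg _) (h₁ f₁ hf₁) 2
  rw [mul_pow] at a b
  linarith

theorem l2norm_cayleyOp_cosetSumZero_le {A : List N}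
    (hA : IsSpectralExpander (1 / 4) (A : Multiset N)) {f : G → ℂ} (hf : f ∈ cosetSumZero N) :
    l2norm (cayleyOp ((A.map N.subtype : List G) : Multiset G) f) ≤ 1 / 4 * l2norm f := by
  have hcard : (0 : ℝ) < Fintype.card N := Nat.cast_pos.2 Fintype.card_pos
  have slice : ∀ x (n : N), cayleyOp ((A.map N.subtype : List G) : Multiset G) f (x * n) =
      cayleyOp (A : Multiset N) (fun k : N => f (x * k)) n := by
    intro x n
    simp [cayleyOp, mul_assoc]
  refine (pow_le_pow_iff_left₀ (l2norm_nonneg _) (mul_nonneg (by norm_num) (l2norm_nonneg _)) two_ne_zero).1 ?_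
  rw [mul_pow]
  refine le_of_mul_le_mul_left ?_ hcard
  rw [mul_left_comm]
  rw [l2norm_sq, l2norm_sq, ← nsmul_eq_mul, ← nsmul_eq_mul,
    ← sum_sum_mul_coset N fun x => ‖f x‖ ^ 2,
    ← sum_sum_mul_coset N fun x => ‖cayleyOp ((A.map N.subtype : List G) : Multiset G) f x‖ ^ 2,
    Finset.mul_sum]
  refine Finset.sum_le_sum fun x _ => ?_
  have := pow_le_pow_left₀ (norm_nonneg _) (hA (fun k : N => f (x * k)) (hf x)) 2
  change l2norm _ ^ 2 ≤ (1 / 4 * l2norm _) ^ 2 at this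
  rw [mul_pow, l2norm_sq, l2norm_sq] at this
  simpa only [slice] using this

omit hN in
theorem sum_comp_quotientMk [Fintype (G ⧸ N)] {M : Type*} [AddCommMonoid M] (F : G ⧸ N → M) :
    ∑ x : G, F (QuotientGroup.mk x) = Fintype.card N • ∑ q, F q := by
  rw [← (Subgroup.groupEquivQuotientProdSubgroup (s := N)).symm.sum_comp, Fintype.sum_prod_type,
    Finset.smul_sum]
  refine Finset.sum_congr rfl fun q _ => ?_
  have : ∀ n : N, F (QuotientGroup.mk (Subgroup.groupEquivQuotientProdSubgroup.symm (q, n))) =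
      F q := by
    intro n
    congr 1
    exact congrArg Prod.fst (Subgroup.groupEquivQuotientProdSubgroup.apply_symm_apply (q, n))
  simp [this]

theorem l2norm_cayleyOp_cosetConstant_le [Fintype (G ⧸ N)] {B : List G}
    (hB : IsSpectralExpander (1 / 4) (B.map (QuotientGroup.mk' N) : Multiset (G ⧸ N)))
    {f : G → ℂ} (hf : f ∈ cosetConstant N) :
    l2norm (cayleyOp (B : Multiset G) f) ≤ 1 / 4 * l2norm f := by
  have hcard : (0 : ℝ) < Fintype.card N := Nat.cast_pos.2 Fintype.card_pos
  obtain ⟨h, rfl⟩ : ∃ h : G ⧸ N → ℂ, f = fun x => h (QuotientGroup.mk x) := by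
    refine ⟨fun q => q.liftOn f fun x y hxy => ?_, rfl⟩
    have := hf.1 x (x⁻¹ * y) (QuotientGroup.leftRel_apply.1 hxy)
    rw [← this, mul_inv_cancel_left]
  have hh : ∑ q, h q = 0 := by
    have := hf.2
    rw [sum_comp_quotientMk] at this
    simpa using this
  have slice : ∀ x, cayleyOp (B : Multiset G) (fun x => h (QuotientGroup.mk x)) x =
      cayleyOp (B.map (QuotientGroup.mk' N) : Multiset (G ⧸ N)) h (QuotientGroup.mk x) := by
    intro x
    simp [cayleyOp, Function.comp_def]
  have norm_comp : ∀ k : G ⧸ N → ℂ,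
      l2norm (fun x : G => k (QuotientGroup.mk x)) ^ 2 = Fintype.card N * l2norm k ^ 2 := by
    intro k
    rw [l2norm_sq, l2norm_sq, ← nsmul_eq_mul, ← sum_comp_quotientMk N fun q => ‖k q‖ ^ 2]
  refine (pow_le_pow_iff_left₀ (l2norm_nonneg _) (mul_nonneg (by norm_num) (l2norm_nonneg _)) two_ne_zero).1 ?_
  rw [funext slice, mul_pow, norm_comp, norm_comp]
  have := pow_le_pow_left₀ (norm_nonneg _) (hB h hh) 2
  change l2norm _ ^ 2 ≤ (1 / 4 * l2norm _) ^ 2 at this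
  rw [mul_pow] at this
  nlinarith

end NormalSubgroup

section Items

variable {V G : Type*}

/-- Extend every item by its copy at the image of its vertex. -/
def doubleItems (T : V → V) (J : List (V × G)) : List (V × G) :=
  J ++ J.map fun p => (T p.1, p.2)

/-- Multiply every item by the group element that belongs to its vertex. -/
def mulItems [Group G] (a : V → G) (J : List (V × G)) : List (V × G) :=
  J.map fun p => (p.1, p.2 * a p.1)

/-- One mixing step on the torus. -/
def mixItems (m : ℕ) (J : List ((ZMod m × ZMod m) × G)) : List ((ZMod m × ZMod m) × G) :=
  doubleItems (torusStep fun _ => 1) (doubleItems (torusStep fun _ => 0)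
    (doubleItems (torusStep id) J))

/-- Every vertex of the torus once, with the identity. -/
def startItems (m : ℕ) (G : Type*) [One G] : List ((ZMod m × ZMod m) × G) :=
  (List.range (m * m)).map fun i => ((((i % m : ℕ) : ZMod m), ((i / m : ℕ) : ZMod m)), 1)

/-- The items after the alternating walk. -/
def walkItems [Group G] (m r : ℕ) (a b : ZMod m × ZMod m → G) : List ((ZMod m × ZMod m) × G) :=
  mulItems b ((mixItems m)^[r] (mulItems a ((mixItems m)^[r] (mulItems b ((mixItems m)^[r]
    (mulItems a (startItems m G)))))))

theorem length_doubleItems (T : V → V) (J : List (V × G)) :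
    (doubleItems T J).length = J.length * 2 := by
  simp [doubleItems, mul_two]

theorem length_mixItems_iterate {m : ℕ} (r : ℕ) (J : List ((ZMod m × ZMod m) × G)) :
    ((mixItems m)^[r] J).length = J.length * 8 ^ r := by
  induction r generalizing J with
  | zero => simp
  | succ r ih =>
    rw [Function.iterate_succ_apply, ih, mixItems, length_doubleItems, length_doubleItems,
      length_doubleItems, pow_succ]
    ring

theorem length_walkItems [Group G] (m r : ℕ) (a b : ZMod m × ZMod m → G) :
    (walkItems m r a b).length = m * m * (8 ^ r * 8 ^ r * 8 ^ r) := by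
  simp [walkItems, mulItems, length_mixItems_iterate, startItems, mul_assoc]

variable [Group G]

/-- The average over the items of the translates of a function of two variables. -/
noncomputable def itemAvg (J : List (V × G)) (Φ : V × G → ℂ) : G → ℂ :=
  fun x => (J.length : ℂ)⁻¹ * (J.map fun p => Φ (p.1, x * p.2)).sum

theorem itemAvg_mulItems (a : V → G) (J : List (V × G)) (Φ : V × G → ℂ) :
    itemAvg (mulItems a J) Φ = itemAvg J (twist a Φ) := by
  ext x
  simp only [itemAvg, mulItems, List.length_map, List.map_map, Function.comp_def, ← mul_assoc]
  rfl

theorem itemAvg_doubleItems (T : V ≃ V) (J : List (V × G)) (Φ : V × G → ℂ) :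
    itemAvg (doubleItems T J) Φ = itemAvg J (fstHalfStep G T Φ) := by
  ext x
  simp only [itemAvg, doubleItems, List.length_append, List.length_map, List.map_append,
    List.sum_append, List.map_map, Function.comp_def, fstHalfStep_apply, List.sum_map_mul_left,
    List.sum_map_add]
  push_cast
  rw [← two_mul, mul_inv]
  ring

theorem itemAvg_mixItems_iterate {m : ℕ} (r : ℕ) (J : List ((ZMod m × ZMod m) × G))
    (Φ : (ZMod m × ZMod m) × G → ℂ) :
    itemAvg ((mixItems m)^[r] J) Φ = itemAvg J ((torusMix m G ^ r) Φ) := by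
  induction r generalizing Φ with
  | zero => rfl
  | succ r ih =>
    rw [Function.iterate_succ_apply', mixItems, itemAvg_doubleItems, itemAvg_doubleItems,
      itemAvg_doubleItems, ih, pow_succ, Module.End.mul_apply, torusMix_apply]

/-- The number of a vertex of the torus. -/
def torusIndex {m : ℕ} (v : ZMod m × ZMod m) : ℕ := v.1.val + m * v.2.val

theorem sum_range_torus {m : ℕ} [NeZero m] {M : Type*} [AddCommMonoid M] (F : ℕ → M) :
    ∑ i ∈ Finset.range (m * m), F i = ∑ v : ZMod m × ZMod m, F (torusIndex v) := by
  have hm : 0 < m := NeZero.pos m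
  refine Finset.sum_nbij' (fun i => (((i % m : ℕ) : ZMod m), ((i / m : ℕ) : ZMod m))) torusIndex
    (fun _ _ => Finset.mem_univ _) (fun v _ => ?_) (fun i hi => ?_) (fun v _ => ?_)
    (fun i hi => ?_)
  · have h1 := v.1.val_lt
    have h2 := v.2.val_lt
    rw [Finset.mem_range, torusIndex]
    nlinarith
  · have h2 : i / m < m := Nat.div_lt_of_lt_mul (Finset.mem_range.1 hi)
    simp only [torusIndex, ZMod.val_natCast, Nat.mod_mod, Nat.mod_eq_of_lt h2]
    exact Nat.mod_add_div i m
  · have h1 := v.1.val_lt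
    ext
    · simp only [torusIndex, Nat.add_mul_mod_self_left, Nat.mod_eq_of_lt h1, ZMod.natCast_val,
        ZMod.cast_id', id]
    · simp only [torusIndex, Nat.add_mul_div_left _ _ hm, Nat.div_eq_of_lt h1, zero_add,
        ZMod.natCast_val, ZMod.cast_id', id]
  · have h2 : i / m < m := Nat.div_lt_of_lt_mul (Finset.mem_range.1 hi)
    simp only [torusIndex, ZMod.val_natCast, Nat.mod_mod, Nat.mod_eq_of_lt h2, Nat.mod_add_div]

theorem itemAvg_startItems {m : ℕ} [NeZero m] (Φ : (ZMod m × ZMod m) × G → ℂ) :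
    itemAvg (startItems m G) Φ = fiberAvg Φ := by
  ext x
  simp only [itemAvg, startItems, List.length_map, List.length_range, List.map_map,
    Function.comp_def, mul_one, fiberAvg, Fintype.card_prod, ZMod.card]
  congr 1
  have : ((List.range (m * m)).map fun i : ℕ =>
      Φ ((((i % m : ℕ) : ZMod m), ((i / m : ℕ) : ZMod m)), x)).sum =
      ∑ i ∈ Finset.range (m * m), Φ ((((i % m : ℕ) : ZMod m), ((i / m : ℕ) : ZMod m)), x) := rfl
  rw [this, sum_range_torus]
  refine Finset.sum_congr rfl fun v _ => ?_
  have h1 := v.1.val_lt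
  have hm : 0 < m := NeZero.pos m
  congr 2
  ext
  · simp only [torusIndex, Nat.add_mul_mod_self_left, Nat.mod_eq_of_lt h1, ZMod.natCast_val,
      ZMod.cast_id', id]
  · simp only [torusIndex, Nat.add_mul_div_left _ _ hm, Nat.div_eq_of_lt h1, zero_add,
      ZMod.natCast_val, ZMod.cast_id', id]

theorem rightAvg_walkItems {m : ℕ} [NeZero m] (r : ℕ) (a b : ZMod m × ZMod m → G) (f : G → ℂ) :
    rightAvg ((walkItems m r a b).map Prod.snd) f =
      fiberAvg (twist a ((torusMix m G ^ r) (twist b ((torusMix m G ^ r) (twist a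
        ((torusMix m G ^ r) (twist b (constLift (ZMod m × ZMod m) f)))))))) := by
  rw [← itemAvg_startItems]
  simp only [← itemAvg_mulItems, ← itemAvg_mixItems_iterate]
  ext x
  simp [rightAvg, itemAvg, walkItems, constLift, Function.comp_def]

end Items

section AlternatingSequence

variable {G : Type*} [Group G]

/-- The periodic sequence of the inverses of the entries of `L`, the entries of `L`, and so on. -/
def altSeq (L : List G) (k : ℕ) : G :=
  if Even (k / L.length) then (L.getD (k % L.length) 1)⁻¹ else L.getD (k % L.length) 1

theorem altSeq_of_lt {L : List G} {k : ℕ} (h : k < L.length) : altSeq L k = (L.getD k 1)⁻¹ := by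
  simp [altSeq, Nat.div_eq_of_lt h, Nat.mod_eq_of_lt h]

theorem altSeq_add_length {L : List G} (hL : 0 < L.length) (k : ℕ) :
    altSeq L (k + L.length) = (altSeq L k)⁻¹ := by
  simp only [altSeq, Nat.add_div_right _ hL, Nat.add_mod_right, Nat.even_add_one]
  split_ifs <;> simp_all

theorem altSeq_add_mul {L : List G} (hL : 0 < L.length) (q k : ℕ) :
    altSeq L (2 * L.length * q + k) = altSeq L k := by
  induction q with
  | zero => simp
  | succ q ih =>
    rw [show 2 * L.length * (q + 1) + k = 2 * L.length * q + k + L.length + L.length by ring,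
      altSeq_add_length hL, altSeq_add_length hL, ih, inv_inv]

theorem sum_range_altSeq {L : List G} (hL : 0 < L.length) (f : G → ℂ) (q : ℕ) :
    (∑ k ∈ Finset.range (2 * L.length * q), fun x => f (x * altSeq L k)) =
      (q * (2 * L.length) : ℂ) • cayleyOp (L : Multiset G) f := by
  have one : (∑ k ∈ Finset.range (2 * L.length), fun x => f (x * altSeq L k)) =
      (2 * L.length : ℂ) • cayleyOp (L : Multiset G) f := by
    have hl : (L.length : ℂ) ≠ 0 := Nat.cast_ne_zero.2 hL.ne'
    ext x
    rw [two_mul, Finset.sum_range_add, Pi.add_apply, Finset.sum_apply, Finset.sum_apply,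
      Pi.smul_apply, smul_eq_mul]
    simp only [cayleyOp, Multiset.map_coe, Multiset.sum_coe, Multiset.coe_card, List.sum_map_add]
    rw [mul_inv_cancel_left₀ (mul_ne_zero two_ne_zero hl), add_comm]
    have e : ∀ F : G → ℂ, (L.map F).sum = ∑ k ∈ Finset.range L.length, F (L.getD k 1) := by
      intro F
      rw [Finset.sum_range, ← List.sum_ofFn]
      congr 1
      refine List.ext_getElem (by simp) fun i h1 h2 => ?_
      simp
    rw [e, e]
    congr 1
    · refine Finset.sum_congr rfl fun k hk => ?_
      rw [add_comm, altSeq_add_length hL, altSeq_of_lt (Finset.mem_range.1 hk), inv_inv]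
    · refine Finset.sum_congr rfl fun k hk => ?_
      rw [altSeq_of_lt (Finset.mem_range.1 hk)]
  induction q with
  | zero => simp
  | succ q ih =>
    rw [mul_add, mul_one, Finset.sum_range_add, ih]
    simp only [altSeq_add_mul hL]
    rw [one, ← add_smul]
    congr 1
    push_cast
    ring

variable [Fintype G]

theorem l2norm_sum_range_altSeq_le {L : List G} (f : G → ℂ) {n : ℕ}
    (hn : 64 * L.length ≤ n) (h0 : L.length = 0 → f = 0)
    (hf : l2norm (cayleyOp (L : Multiset G) f) ≤ 1 / 4 * l2norm f) :
    l2norm (∑ k ∈ Finset.range n, fun x => f (x * altSeq L k)) ≤ n * (9 / 32) * l2norm f := by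
  rcases Nat.eq_zero_or_pos L.length with hL | hL
  · have : (∑ k ∈ Finset.range n, fun x => f (x * altSeq L k)) = 0 := by
      rw [h0 hL]
      exact Finset.sum_eq_zero fun _ _ => rfl
    rw [this, h0 hL]
    simp
  · set q := n / (2 * L.length)
    set t := n % (2 * L.length)
    have hnq : n = 2 * L.length * q + t := (Nat.div_add_mod n _).symm
    have ht : t ≤ 2 * L.length := (Nat.mod_lt n (by omega)).le
    have e : (∑ k ∈ Finset.range n, fun x => f (x * altSeq L k)) =
        (q * (2 * L.length) : ℂ) • cayleyOp (L : Multiset G) f +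
          ∑ k ∈ Finset.range t, fun x => f (x * altSeq L (2 * L.length * q + k)) := by
      rw [hnq, Finset.sum_range_add, sum_range_altSeq hL]
    rw [e]
    refine (l2norm_add_le _ _).trans ?_
    have h2 : l2norm (∑ k ∈ Finset.range t, fun x => f (x * altSeq L (2 * L.length * q + k))) ≤
        t * l2norm f := by
      refine (l2norm_sum_le _ _).trans (le_of_eq ?_)
      refine (Finset.sum_congr rfl fun k _ =>
        l2norm_comp_equiv (Equiv.mulRight (altSeq L (2 * L.length * q + k))) f).trans ?_
      simp
    have h1 : l2norm ((q * (2 * L.length) : ℂ) • cayleyOp (L : Multiset G) f) ≤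
        q * (2 * L.length) * (1 / 4 * l2norm f) := by
      rw [l2norm_smul]
      have : ‖(q * (2 * L.length) : ℂ)‖ = q * (2 * L.length) := by simp
      rw [this]
      gcongr
    have c1 : (n : ℝ) = 2 * L.length * q + t := by exact_mod_cast hnq
    have c2 : (t : ℝ) ≤ 2 * L.length := by exact_mod_cast ht
    have c3 : (64 : ℝ) * L.length ≤ n := by exact_mod_cast hn
    have := l2norm_nonneg f
    have c4 : q * (2 * L.length) * (1 / 4) + (t : ℝ) ≤ n * (9 / 32) := by linarith
    have c5 := mul_le_mul_of_nonneg_right c4 this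
    linarith

theorem avgContracts_altSeq {m : ℕ} [NeZero m] {L : List G} (hn : 64 * L.length ≤ m * m)
    {W : Submodule ℂ (G → ℂ)} (h0 : L.length = 0 → ∀ f ∈ W, f = 0)
    (hW : ∀ f ∈ W, l2norm (cayleyOp (L : Multiset G) f) ≤ 1 / 4 * l2norm f) :
    AvgContracts W (9 / 32) fun v : ZMod m × ZMod m => altSeq L (torusIndex v) := by
  intro f hf
  have e : fiberAvg (twist (fun v : ZMod m × ZMod m => altSeq L (torusIndex v))
      (constLift (ZMod m × ZMod m) f)) =
      ((m * m : ℕ) : ℂ)⁻¹ • ∑ k ∈ Finset.range (m * m), fun x => f (x * altSeq L k) := by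
    rw [sum_range_torus fun k => fun x => f (x * altSeq L k)]
    ext x
    rw [Pi.smul_apply, Finset.sum_apply, smul_eq_mul, fiberAvg, Fintype.card_prod, ZMod.card]
    rfl
  have h := l2norm_sum_range_altSeq_le f hn (fun h => h0 h f hf) (hW f hf)
  have hm : (0 : ℝ) < (m * m : ℕ) := by
    have := NeZero.pos m
    exact_mod_cast Nat.mul_pos this this
  rw [e, l2norm_smul, norm_inv, Complex.norm_natCast, inv_mul_le_iff₀ hm]
  linarith

end AlternatingSequence

theorem exists_mixing_exponent : ∃ r : ℕ, (1 - 1 / 235200 : ℝ) ^ r ≤ 7 / 128 := by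
  obtain ⟨r, hr⟩ := exists_pow_lt_of_lt_one (show (0 : ℝ) < 7 / 128 by norm_num)
    (show (1 - 1 / 235200 : ℝ) < 1 by norm_num)
  exact ⟨r, hr.le⟩

theorem eq_one_of_isExpandingGenerating_nil {G : Type*} [Group G] [Fintype G] {lam : ℝ}
    (h : IsExpandingGenerating lam (([] : List G) : Multiset G)) (x : G) : x = 1 := by
  have := h.generates
  simp only [Multiset.coe_nil, Multiset.notMem_zero, Set.ofPred_false,
    Subgroup.closure_empty] at this
  rw [← Subgroup.mem_bot, this]
  exact Subgroup.mem_top _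

theorem isExpandingGenerating_nil {G : Type*} [Group G] [Fintype G] (h : ∀ x : G, x = 1) :
    IsExpandingGenerating (1 / 4) (([] : List G) : Multiset G) := by
  refine ⟨?_, fun v _ => ?_⟩
  · rw [eq_top_iff]
    intro x _
    rw [h x]
    exact one_mem _
  · have : cayleyOp (([] : List G) : Multiset G) v = 0 := by
      ext x
      simp [cayleyOp]
    rw [this, WithLp.toLp_zero, norm_zero]
    positivity

/-- The elements collected by the alternating walk on the torus, together with their inverses, form
an expanding generating multiset. -/
theorem isExpandingGenerating_walkItems {G : Type*} [Group G] [Fintype G] (N : Subgroup G)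
    [N.Normal] [Fintype N] [Fintype (G ⧸ N)] {A : List N} {B : List G}
    (hA : IsExpandingGenerating (1 / 4) (A : Multiset N))
    (hB : IsExpandingGenerating (1 / 4) (B.map (QuotientGroup.mk' N) : Multiset (G ⧸ N)))
    {m : ℕ} [NeZero m] (hm : 64 * (A.length + B.length) ≤ m * m) {r : ℕ}
    (hr : (1 - 1 / 235200 : ℝ) ^ r ≤ 7 / 128) :
    let S := (walkItems m r (fun v => altSeq (A.map N.subtype) (torusIndex v))
      fun v => altSeq B (torusIndex v)).map Prod.snd
    IsExpandingGenerating (1 / 4) ((S ++ S.map fun s => s⁻¹ : List G) : Multiset G) := by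
  intro S
  have hmix := (isMixing_torusMix (m := m) (G := G)).pow (by norm_num) r
  have hμ : (0 : ℝ) ≤ (1 - 1 / 235200 : ℝ) ^ r := by positivity
  have hl : (9 / 32 : ℝ) + 4 * (1 - 1 / 235200 : ℝ) ^ r ≤ 1 / 2 := by linarith
  refine isExpandingGenerating_append_inv ?_ fun f hf => ?_
  · rw [← List.length_pos_iff_ne_nil, List.length_map, length_walkItems]
    have := NeZero.pos m
    positivity
  · refine l2norm_rightAvg_le_of_coset N (by norm_num) (fun f hf => ?_) (fun f hf => ?_) hf
    · rw [rightAvg_walkItems]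
      refine hmix.walk_le hμ (by norm_num) hl (cosetConstant_translate N) (Or.inr ?_) hf
      refine avgContracts_altSeq (by omega) (fun h0 f hf => ?_)
        fun f hf => l2norm_cayleyOp_cosetConstant_le N hB.spectral hf
      have hB0 : B = [] := List.length_eq_zero_iff.1 h0
      subst hB0
      have htop : ∀ x : G, x ∈ N := fun x =>
        (QuotientGroup.eq_one_iff x).1 (eq_one_of_isExpandingGenerating_nil hB _)
      have hc : ∀ x, f x = f 1 := fun x => by simpa using hf.1 1 x (htop x)
      have hs := hf.2
      simp only [hc, Finset.sum_const, Finset.card_univ, nsmul_eq_mul, mul_eq_zero,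
        Nat.cast_eq_zero, Fintype.card_ne_zero, false_or] at hs
      ext x
      rw [hc, hs, Pi.zero_apply]
    · rw [rightAvg_walkItems]
      refine hmix.walk_le hμ (by norm_num) hl (cosetSumZero_translate N) (Or.inl ?_) hf
      refine avgContracts_altSeq (by rw [List.length_map]; omega) (fun h0 f hf => ?_)
        fun f hf => l2norm_cayleyOp_cosetSumZero_le N hA.spectral hf
      have hA0 : A = [] := by simpa using h0
      subst hA0
      have h1 : ∀ n : N, n = 1 := eq_one_of_isExpandingGenerating_nil hA
      ext x
      have hx := hf x
      have hu : (Finset.univ : Finset N) = {1} := by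
        ext n
        simpa using h1 n
      simpa [hu] using hx

namespace GroupRAM

variable {G : Type*} [Group G]

/-- Started in `s`, the program `p` halts after at most `b` steps in a state that satisfies `Q`. -/
def HaltsIn (p : Program) (s : State G) (b : ℕ) (Q : State G → Prop) : Prop :=
  ∃ t s', Run p s t s' ∧ t ≤ b ∧ Q s'

theorem HaltsIn.mono {p : Program} {s : State G} {b b' : ℕ} {Q Q' : State G → Prop}
    (h : HaltsIn p s b Q) (hb : b ≤ b') (hQ : ∀ s, Q s → Q' s) : HaltsIn p s b' Q' := by
  obtain ⟨t, s', hr, ht, hs⟩ := h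
  exact ⟨t, s', hr, ht.trans hb, hQ _ hs⟩

theorem HaltsIn.seq {p q : Program} {s : State G} {b b' : ℕ} {Q Q' : State G → Prop}
    (h : HaltsIn p s b Q) (h' : ∀ s, Q s → HaltsIn q s b' Q') :
    HaltsIn (.seq p q) s (b + b') Q' := by
  obtain ⟨t, s', hr, ht, hs⟩ := h
  obtain ⟨t', s'', hr', ht', hs'⟩ := h' s' hs
  exact ⟨t + t', s'', .seq hr hr', by omega, hs'⟩

theorem HaltsIn.ite {p q : Program} {i : ℕ} {s : State G} {b : ℕ} {Q : State G → Prop}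
    (h : s.num i ≠ 0 → HaltsIn p s b Q) (h' : s.num i = 0 → HaltsIn q s b Q) :
    HaltsIn (.ite i p q) s (b + 1) Q := by
  by_cases hi : s.num i = 0
  · obtain ⟨t, s', hr, ht, hs⟩ := h' hi
    exact ⟨t + 1, s', .ite_false hi hr, by omega, hs⟩
  · obtain ⟨t, s', hr, ht, hs⟩ := h hi
    exact ⟨t + 1, s', .ite_true hi hr, by omega, hs⟩

theorem HaltsIn.loop {p : Program} {i : ℕ} {b n : ℕ} {I : ℕ → State G → Prop}
    (hstep : ∀ k < n, ∀ s, I k s → s.num i ≠ 0 ∧ HaltsIn p s b (I (k + 1)))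
    (hend : ∀ s, I n s → s.num i = 0) {s : State G} (h : I 0 s) :
    HaltsIn (.loop i p) s (n * (b + 1) + 1) (I n) := by
  have key : ∀ j k, k + j = n → ∀ s, I k s → HaltsIn (.loop i p) s (j * (b + 1) + 1) (I n) := by
    intro j
    induction j with
    | zero =>
      rintro k rfl s hs
      exact ⟨1, s, .loop_done (hend s hs), by omega, hs⟩
    | succ j ih =>
      intro k hk s hs
      obtain ⟨hi, t, s', hr, ht, hs'⟩ := hstep k (by omega) s hs
      obtain ⟨t', s'', hr', ht', hs''⟩ := ih (k + 1) (by omega) s' hs'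
      exact ⟨t + t' + 1, s'', .loop_step hi hr hr', by rw [add_mul]; omega, hs''⟩
  exact key n 0 (by omega) s h

/-- The instructions of a list, one after the other. -/
def block : List Instr → Program
  | [] => .instr (.const 6 0)
  | [a] => .instr a
  | a :: l => .seq (.instr a) (block l)

/-- The state after the instructions of a list. -/
def execs (l : List Instr) (s : State G) : State G := l.foldl Instr.exec s

theorem haltsIn_block {l : List Instr} (hl : l ≠ []) {s : State G} {Q : State G → Prop}
    (h : Q (execs l s)) : HaltsIn (block l) s l.length Q := by
  induction l generalizing s with
  | nil => exact absurd rfl hl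
  | cons a l ih =>
    cases l with
    | nil => exact ⟨1, _, .instr a s, le_rfl, h⟩
    | cons a' l =>
      obtain ⟨t, s', hr, ht, hs⟩ := ih (by simp) (s := a.exec s) h
      exact ⟨1 + t, s', .seq (.instr a s) hr, by simp at ht ⊢; omega, hs⟩

/-- Copy the inverses of `num[10]` group cells from the address `num[8]` to `num[9]`. -/
def copyInv : Program :=
  .loop 10 (block [.inv 9 8, .add 8 8 2, .add 9 9 2, .sub 10 10 2])

theorem haltsIn_copyInv {s : State G} (h2 : s.num 2 = 1) :
    HaltsIn copyInv s (s.num 10 * 5 + 1) fun s' =>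
      (∀ j, j ≠ 8 → j ≠ 9 → j ≠ 10 → s'.num j = s.num j) ∧
      s'.num 9 = s.num 9 + s.num 10 ∧
      (∀ j, (s.num 9 ≤ j → s.num 9 + s.num 10 ≤ j) → s'.grp j = s.grp j) ∧
      (s.num 8 < s.num 9 →
        ∀ k < s.num 10, s'.grp (s.num 9 + k) = (s'.grp (s.num 8 + k))⁻¹) ∧
      (s.num 8 = s.num 9 → ∀ k < s.num 10, s'.grp (s.num 9 + k) = (s.grp (s.num 9 + k))⁻¹) := by
  refine (HaltsIn.loop (n := s.num 10) (b := 4) (I := fun k s' =>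
      (∀ j, j ≠ 8 → j ≠ 9 → j ≠ 10 → s'.num j = s.num j) ∧
      s'.num 8 = s.num 8 + k ∧ s'.num 9 = s.num 9 + k ∧ s'.num 10 = s.num 10 - k ∧
      (∀ j, (s.num 9 ≤ j → s.num 9 + k ≤ j) → s'.grp j = s.grp j) ∧
      (s.num 8 < s.num 9 → ∀ i < k, s'.grp (s.num 9 + i) = (s'.grp (s.num 8 + i))⁻¹) ∧
      (s.num 8 = s.num 9 → ∀ i < k, s'.grp (s.num 9 + i) = (s.grp (s.num 9 + i))⁻¹))
    ?_ ?_ ?_).mono le_rfl ?_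
  · rintro k hk u ⟨h, u8, u9, u10, hf, hlt, heq⟩
    have u2 : u.num 2 = 1 := by rw [h 2] <;> simp [h2]
    refine ⟨by omega, haltsIn_block (by simp) ?_⟩
    refine ⟨fun j h8 h9 h10 => ?_, ?_, ?_, ?_, fun j hj => ?_, fun hl i hi => ?_, fun he i hi => ?_⟩
    · simp [execs, Instr.exec, h8, h9, h10, h]
    · simp [execs, Instr.exec, u8, u2]; omega
    · simp [execs, Instr.exec, u9, u2]; omega
    · simp [execs, Instr.exec, u10, u2]; omega
    · have : j ≠ s.num 9 + k := by omega
      simp [execs, Instr.exec, u9, this]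
      exact hf j (by omega)
    · have e1 : s.num 8 + i ≠ s.num 9 + k := by omega
      simp only [execs, Instr.exec, u9, u8, List.foldl_cons, List.foldl_nil]
      rw [Function.update_of_ne e1]
      rcases Nat.lt_succ_iff_lt_or_eq.1 hi with hi | rfl
      · rw [Function.update_of_ne (by omega)]
        exact hlt hl i hi
      · rw [Function.update_self]
    · simp only [execs, Instr.exec, u9, u8, List.foldl_cons, List.foldl_nil]
      rcases Nat.lt_succ_iff_lt_or_eq.1 hi with hi | rfl
      · rw [Function.update_of_ne (by omega)]
        exact heq he i hi
      · rw [Function.update_self, he, hf _ (by omega)]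
  · rintro u ⟨_, _, _, h, _⟩
    omega
  · exact ⟨fun _ _ _ _ => rfl, rfl, rfl, rfl, fun _ _ => rfl, fun _ i hi => absurd hi (by omega),
      fun _ i hi => absurd hi (by omega)⟩
  · rintro u ⟨h1, _, h3, _, h5, h6, h7⟩
    exact ⟨h1, h3, h5, h6, h7⟩

/-- Write the first `num[4]` terms of the alternating sequence of the list of length `num[len]` at
the address `num[src]` to the address `num[dst]`. -/
def tableCode (src dst len : ℕ) : Program :=
  .seq (block [.add 8 src 21, .add 9 dst 21, .add 10 len 21]) (.seq copyInv
    (.seq (block [.add 8 dst 21, .add 10 4 21]) copyInv))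

theorem haltsIn_tableCode {s : State G} {src dst len : ℕ} (h2 : s.num 2 = 1) (h21 : s.num 21 = 0)
    (hdst : dst ≠ 8 ∧ dst ≠ 9 ∧ dst ≠ 10) (hlen : len ≠ 8 ∧ len ≠ 9 ∧ len ≠ 10) {L : List G}
    (hL : s.num len = L.length) (hin : ∀ k < L.length, s.grp (s.num src + k) = L.getD k 1)
    (hsep : s.num src + L.length ≤ s.num dst) (hone : ∀ j, s.num dst ≤ j →
      j < s.num dst + s.num 4 → s.grp j = 1) :
    HaltsIn (tableCode src dst len) s (L.length * 5 + s.num 4 * 5 + 7) fun s' =>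
      (∀ j, j ≠ 8 → j ≠ 9 → j ≠ 10 → s'.num j = s.num j) ∧
      (∀ j, (s.num dst ≤ j → s.num dst + L.length + s.num 4 ≤ j) → s'.grp j = s.grp j) ∧
      ∀ k < s.num 4, s'.grp (s.num dst + k) = altSeq L k := by
  set d := s.num dst with hd
  set n := s.num 4 with hn
  refine HaltsIn.mono (HaltsIn.seq (b := 3) (b' := L.length * 5 + 1 + (2 + (n * 5 + 1)))
    (Q := fun u => (∀ j, j ≠ 8 → j ≠ 9 → j ≠ 10 → u.num j = s.num j) ∧ u.grp = s.grp ∧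
      u.num 8 = s.num src ∧ u.num 9 = d ∧ u.num 10 = L.length)
    (haltsIn_block (by simp) ?_) ?_) (by omega) fun _ h => h
  · refine ⟨fun j h8 h9 h10 => ?_, rfl, ?_, ?_, ?_⟩
    · simp [execs, Instr.exec, h8, h9, h10]
    · simp [execs, Instr.exec, h21]
    · simp [execs, Instr.exec, h21, hdst, hd]
    · simp [execs, Instr.exec, h21, hlen, hL]
  rintro u ⟨hu, hug, u8, u9, u10⟩
  have u2 : u.num 2 = 1 := by rw [hu 2] <;> simp [h2]
  have hcopy := haltsIn_copyInv u2
  rw [u8, u9, u10] at hcopy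
  refine HaltsIn.seq hcopy ?_
  rintro v ⟨hv, v9, hvg, hvlt, -⟩
  have v21 : v.num 21 = 0 := by rw [hv 21, hu 21] <;> simp [h21]
  have vdst : v.num dst = d := by rw [hv dst, hu dst] <;> simp [hdst]
  have v4 : v.num 4 = n := by rw [hv 4, hu 4] <;> simp
  refine HaltsIn.seq (b := 2)
    (Q := fun w => (∀ j, j ≠ 8 → j ≠ 9 → j ≠ 10 → w.num j = s.num j) ∧ w.grp = v.grp ∧
      w.num 8 = d ∧ w.num 9 = d + L.length ∧ w.num 10 = n)
    (haltsIn_block (by simp) ?_) ?_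
  · refine ⟨fun j h8 h9 h10 => ?_, rfl, ?_, ?_, ?_⟩
    · simp [execs, Instr.exec, h8, h10, hv j h8 h9 h10, hu j h8 h9 h10]
    · simp [execs, Instr.exec, v21, vdst]
    · simp [execs, Instr.exec, v9]
    · simp [execs, Instr.exec, v21, v4]
  rintro w ⟨hw, hwg, w8, w9, w10⟩
  have w2 : w.num 2 = 1 := by rw [hw 2] <;> simp [h2]
  have hcopy := haltsIn_copyInv w2
  rw [w8, w9, w10] at hcopy
  refine hcopy.mono (by omega) ?_
  rintro x ⟨hx, -, hxg, hxlt, hxeq⟩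
  have frame : ∀ j, (d ≤ j → d + L.length + n ≤ j) → x.grp j = s.grp j := by
    intro j hj
    rw [hxg j (by omega), hwg, hvg j (by omega), hug]
  refine ⟨fun j h8 h9 h10 => by rw [hx j h8 h9 h10, hw j h8 h9 h10], frame, ?_⟩
  rcases Nat.eq_zero_or_pos L.length with h0 | hpos
  · intro k hk
    have hL0 : L = [] := List.length_eq_zero_iff.1 h0
    have e := hxeq (by omega) k hk
    rw [h0, add_zero, hwg, hvg _ (by omega), hug, hone _ (by omega) (by omega)] at e
    rw [e, hL0]
    simp [altSeq]
  · intro k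
    induction k using Nat.strong_induction_on with
    | _ k ih =>
      intro hk
      rcases lt_or_ge k L.length with hkL | hkL
      · rw [altSeq_of_lt hkL, hxg _ (by omega), hwg, hvlt (by omega) k hkL,
          hvg _ (by omega), hug, hin k hkL]
      · have e := hxlt (by omega) (k - L.length) (by omega)
        rw [ih (k - L.length) (by omega) (by omega),
          show d + L.length + (k - L.length) = d + k by omega] at e
        rw [e, ← altSeq_add_length hpos, Nat.sub_add_cancel hkL]

/-- Put the least `m` with `num[5] ≤ m²` into `num[3]` and `m²` into `num[4]`. -/
def sqrtCode : Program :=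
  .loop 6 (block [.add 4 4 3, .add 3 3 2, .add 4 4 3, .sub 6 5 4])

theorem haltsIn_sqrtCode {s : State G} (h2 : s.num 2 = 1) (h3 : s.num 3 = 0) (h4 : s.num 4 = 0)
    (h6 : s.num 6 = s.num 5) :
    ∃ m, s.num 5 ≤ m * m ∧ m * m ≤ 4 * s.num 5 ∧ HaltsIn sqrtCode s (m * 5 + 1) fun s' =>
      (∀ j, j ≠ 3 → j ≠ 4 → j ≠ 6 → s'.num j = s.num j) ∧ s'.grp = s.grp ∧
      s'.num 3 = m ∧ s'.num 4 = m * m := by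
  classical
  have hex : ∃ m, s.num 5 ≤ m * m := ⟨s.num 5, Nat.le_mul_self _⟩
  set m := Nat.find hex with hm
  have hmin : ∀ k < m, k * k < s.num 5 := fun k hk => not_le.1 (Nat.find_min hex hk)
  refine ⟨m, Nat.find_spec hex, ?_, ?_⟩
  · rcases Nat.eq_zero_or_pos m with h0 | hpos
    · simp [h0]
    · obtain ⟨k, hk⟩ : ∃ k, m = k + 1 := ⟨m - 1, by omega⟩
      have := hmin k (by omega)
      rw [hk]
      nlinarith
  refine (HaltsIn.loop (n := m) (b := 4) (I := fun k s' =>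
      (∀ j, j ≠ 3 → j ≠ 4 → j ≠ 6 → s'.num j = s.num j) ∧ s'.grp = s.grp ∧
      s'.num 3 = k ∧ s'.num 4 = k * k ∧ s'.num 6 = s.num 5 - k * k)
    ?_ ?_ ?_).mono le_rfl ?_
  · rintro k hk u ⟨h, hg, u3, u4, u6⟩
    have u2 : u.num 2 = 1 := by rw [h 2] <;> simp [h2]
    have u5 : u.num 5 = s.num 5 := by rw [h 5] <;> simp
    have := hmin k hk
    refine ⟨by omega, haltsIn_block (by simp) ⟨fun j h3 h4 h6 => ?_, ?_, ?_, ?_, ?_⟩⟩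
    · simp [execs, Instr.exec, h3, h4, h6, h]
    · simp [execs, Instr.exec, hg]
    · simp [execs, Instr.exec, u3, u2]
    · simp [execs, Instr.exec, u3, u2, u4]; ring
    · simp [execs, Instr.exec, u3, u2, u4, u5]; congr 1; ring
  · rintro u ⟨-, -, -, -, h⟩
    have : s.num 5 ≤ m * m := Nat.find_spec hex
    omega
  · exact ⟨fun _ _ _ _ => rfl, rfl, h3, by simp [h4], by simp [h6]⟩
  · rintro u ⟨h1, h2, h3, h4, -⟩
    exact ⟨h1, h2, h3, h4⟩

end GroupRAM

namespace GroupRAM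

variable {G : Type*} [Group G]

theorem register_ne {c a : ℕ} (h : c < 40) :
    c ≠ 40 + a ∧ c ≠ 41 + a ∧ c ≠ 42 + a ∧ 40 + a ≠ c ∧ 41 + a ≠ c ∧ 42 + a ≠ c := by
  omega

theorem forty_add_add_one (a : ℕ) : 40 + a + 1 = 41 + a := by
  omega

/-- The vertices of the torus are stored in the cells `40 + 3 i`, `41 + 3 i`, the multiples of
`num[3]` in the cells `42 + 3 i`, and the identity in the first `num[4]` group cells. -/
def initCode : Program :=
  .seq (block [.add 14 4 21, .const 15 40, .const 16 42, .const 17 0, .const 18 0, .const 20 0])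
    (.loop 14 (.seq (block [.store 15 17, .add 6 15 2, .store 6 18, .sub 6 20 17, .store 16 6,
        .one 20, .add 15 15 22, .add 20 20 2, .add 17 17 2, .sub 6 3 17, .sub 14 14 2])
      (.ite 6 (block [.const 6 0]) (block [.const 17 0, .add 18 18 2, .add 16 16 22]))))

theorem haltsIn_initCode {s : State G} {m : ℕ} (h2 : s.num 2 = 1) (h3 : s.num 3 = m)
    (h4 : s.num 4 = m * m) (h21 : s.num 21 = 0) (h22 : s.num 22 = 3) :
    HaltsIn initCode s (m * m * 16 + 7) fun s' =>
      (∀ j < 40, j ≠ 6 → (j < 14 ∨ 20 < j) → s'.num j = s.num j) ∧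
      (∀ j, m * m ≤ j → s'.grp j = s.grp j) ∧
      (∀ i < m * m, s'.num (40 + 3 * i) = i % m ∧ s'.num (41 + 3 * i) = i / m ∧ s'.grp i = 1) ∧
      ∀ y < m, s'.num (42 + 3 * y) = m * y := by
  refine HaltsIn.mono (HaltsIn.seq (b := 6) (b' := m * m * (15 + 1) + 1)
    (Q := fun u => (∀ j < 40, j ≠ 6 → (j < 14 ∨ 20 < j) → u.num j = s.num j) ∧ u.grp = s.grp ∧
      u.num 14 = m * m ∧ u.num 15 = 40 ∧ u.num 16 = 42 ∧ u.num 17 = 0 ∧ u.num 18 = 0 ∧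
      u.num 20 = 0) (haltsIn_block (by simp) ?_) ?_) (by omega) fun _ h => h
  · refine ⟨fun j hj h6 h => ?_, rfl, ?_, ?_, ?_, ?_, ?_, ?_⟩
    · have : j ≠ 14 ∧ j ≠ 15 ∧ j ≠ 16 ∧ j ≠ 17 ∧ j ≠ 18 ∧ j ≠ 20 := by omega
      simp [execs, Instr.exec, this]
    all_goals simp [execs, Instr.exec, h4, h21]
  rintro a ⟨ha, hag, a14, a15, a16, a17, a18, a20⟩
  refine (HaltsIn.loop (n := m * m) (b := 15) (I := fun k u =>
      (∀ j < 40, j ≠ 6 → (j < 14 ∨ 20 < j) → u.num j = s.num j) ∧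
      (∀ j, k ≤ j → u.grp j = s.grp j) ∧ u.num 14 = m * m - k ∧ u.num 15 = 40 + 3 * k ∧
      u.num 16 = 42 + 3 * (k / m) ∧ u.num 17 = k % m ∧ u.num 18 = k / m ∧ u.num 20 = k ∧
      (∀ i < k, u.num (40 + 3 * i) = i % m ∧ u.num (41 + 3 * i) = i / m ∧ u.grp i = 1) ∧
      ∀ y, m * y < k → u.num (42 + 3 * y) = m * y) ?_ ?_ ?_).mono le_rfl ?_
  · rintro k hk u ⟨hu, hug, u14, u15, u16, u17, u18, u20, uit, urow⟩
    have hm : 0 < m := Nat.pos_of_ne_zero fun h => by simp [h] at hk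
    have u2 : u.num 2 = 1 := by rw [hu 2] <;> simp [h2]
    have u3 : u.num 3 = m := by rw [hu 3] <;> simp [h3]
    have u22 : u.num 22 = 3 := by rw [hu 22] <;> simp [h22]
    refine ⟨by omega, ?_⟩
    set x := k % m with hx
    set y := k / m with hy
    have hxm : x < m := Nat.mod_lt _ hm
    have hk' : x + m * y = k := Nat.mod_add_div k m
    refine HaltsIn.mono (HaltsIn.seq (b := 11) (b' := 4) (Q := fun v =>
      (∀ j < 40, j ≠ 6 → (j < 14 ∨ 20 < j) → v.num j = s.num j) ∧
      v.num 6 = m - (x + 1) ∧ v.num 14 = m * m - (k + 1) ∧ v.num 15 = 40 + 3 * (k + 1) ∧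
      v.num 16 = 42 + 3 * y ∧ v.num 17 = x + 1 ∧ v.num 18 = y ∧ v.num 20 = k + 1 ∧
      (∀ j, 40 ≤ j → v.num j = if j = 42 + 3 * y then m * y else if j = 41 + 3 * k then y else
        if j = 40 + 3 * k then x else u.num j) ∧ v.grp = Function.update u.grp k 1)
      (haltsIn_block (by simp) ?_) ?_) (by omega) fun _ h => h
    · refine ⟨fun j hj h6 h => ?_, ?_, ?_, ?_, ?_, ?_, ?_, ?_, fun j hj => ?_, ?_⟩
      · have : j ≠ 14 ∧ j ≠ 15 ∧ j ≠ 16 ∧ j ≠ 17 ∧ j ≠ 18 ∧ j ≠ 20 := by omega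
        simp [execs, Instr.exec, u2, u15, u16, this, h6, hj, register_ne,
          forty_add_add_one, hu j hj h6 h]
      · simp [execs, Instr.exec, u2, u3, u15, u16, u17, register_ne,
          forty_add_add_one]
      · simp [execs, Instr.exec, u2, u14, u15, u16, register_ne,
          forty_add_add_one, Nat.sub_sub]
      · simp [execs, Instr.exec, u2, u15, u16, u22, register_ne,
          mul_add, add_assoc]
      · simp [execs, Instr.exec, u2, u15, u16, register_ne,
          forty_add_add_one]
      · simp [execs, Instr.exec, u2, u15, u16, u17, register_ne,
          forty_add_add_one]
      · simp [execs, Instr.exec, u2, u15, u16, u18, register_ne,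
          forty_add_add_one]
      · simp [execs, Instr.exec, u2, u15, u16, u20, register_ne,
          forty_add_add_one]
      · have : j ≠ 6 ∧ j ≠ 14 ∧ j ≠ 15 ∧ j ≠ 17 ∧ j ≠ 18 ∧ j ≠ 20 := by omega
        have e : k - x = m * y := by omega
        simp [execs, Instr.exec, Function.update_apply, u2, u15, u16, u17, u18, u20, this, e,
          register_ne, forty_add_add_one]
      · simp [execs, Instr.exec, u2, u15, u16, u20, register_ne,
          forty_add_add_one]
    rintro v ⟨hv, v6, v14, v15, v16, v17, v18, v20, vnum, vg⟩
    have v2 : v.num 2 = 1 := by rw [hv 2] <;> simp [h2]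
    have v22 : v.num 22 = 3 := by rw [hv 22] <;> simp [h22]
    have vgf : ∀ j, k + 1 ≤ j → v.grp j = s.grp j := by
      intro j hj
      rw [vg, Function.update_of_ne (by omega), hug j (by omega)]
    have vit : ∀ i < k + 1,
        v.num (40 + 3 * i) = i % m ∧ v.num (41 + 3 * i) = i / m ∧ v.grp i = 1 := by
      intro i hi
      by_cases hik : i = k
      · rw [hik]
        exact ⟨by rw [vnum _ (by omega), if_neg (by omega), if_neg (by omega), if_pos rfl],
          by rw [vnum _ (by omega), if_neg (by omega), if_pos rfl], by rw [vg, Function.update_self]⟩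
      · obtain ⟨p, q, t⟩ := uit i (by omega)
        exact ⟨by rw [vnum _ (by omega), if_neg (by omega), if_neg (by omega), if_neg (by omega), p],
          by rw [vnum _ (by omega), if_neg (by omega), if_neg (by omega), if_neg (by omega), q],
          by rw [vg, Function.update_of_ne hik, t]⟩
    have vrow : ∀ z, m * z < k + 1 → v.num (42 + 3 * z) = m * z := by
      intro z hz
      rw [vnum _ (by omega)]
      by_cases hzy : z = y
      · rw [hzy, if_pos rfl]
      · rw [if_neg (by omega), if_neg (by omega), if_neg (by omega)]
        apply urow
        rcases Nat.lt_succ_iff_lt_or_eq.1 hz with h | h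
        · exact h
        · exfalso
          apply hzy
          rw [hy, ← h, Nat.mul_div_cancel_left _ hm]
    refine HaltsIn.ite (b := 3) (fun h0 => ?_) (fun h0 => ?_)
    · have hlt : x + 1 < m := by omega
      have e1 : (k + 1) % m = x + 1 := by
        rw [← hk', show x + m * y + 1 = x + 1 + m * y by ring, Nat.add_mul_mod_self_left,
          Nat.mod_eq_of_lt hlt]
      have e2 : (k + 1) / m = y := by
        rw [← hk', show x + m * y + 1 = x + 1 + m * y by ring, Nat.add_mul_div_left _ _ hm,
          Nat.div_eq_of_lt hlt, zero_add]
      refine (haltsIn_block (by simp) ?_).mono (show 1 ≤ 3 by omega) fun _ h => h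
      rw [e1, e2]
      refine ⟨fun j hj h6 h => ?_, vgf, ?_, ?_, ?_, ?_, ?_, ?_, fun i hi => ?_, fun z hz => ?_⟩
      · simp [execs, Instr.exec, h6, hv j hj h6 h]
      · simp [execs, Instr.exec, v14]
      · simp [execs, Instr.exec, v15]
      · simp [execs, Instr.exec, v16]
      · simp [execs, Instr.exec, v17]
      · simp [execs, Instr.exec, v18]
      · simp [execs, Instr.exec, v20]
      · have := vit i hi
        simpa [execs, Instr.exec, Function.update_apply, register_ne] using this
      · have := vrow z hz
        simpa [execs, Instr.exec, Function.update_apply, register_ne] using this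
    · have heq : x + 1 = m := by omega
      have e0 : k + 1 = m * (y + 1) := by rw [mul_add, mul_one]; omega
      have e1 : (k + 1) % m = 0 := by rw [e0, Nat.mul_mod_right]
      have e2 : (k + 1) / m = y + 1 := by rw [e0, Nat.mul_div_cancel_left _ hm]
      refine (haltsIn_block (by simp) ?_).mono (show 3 ≤ 3 by omega) fun _ h => h
      rw [e1, e2]
      refine ⟨fun j hj h6 h => ?_, vgf, ?_, ?_, ?_, ?_, ?_, ?_, fun i hi => ?_, fun z hz => ?_⟩
      · have : j ≠ 16 ∧ j ≠ 17 ∧ j ≠ 18 := by omega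
        simp [execs, Instr.exec, this, hv j hj h6 h]
      · simp [execs, Instr.exec, v14]
      · simp [execs, Instr.exec, v15]
      · simp [execs, Instr.exec, v16, v22, mul_add, add_assoc]
      · simp [execs, Instr.exec]
      · simp [execs, Instr.exec, v18, v2]
      · simp [execs, Instr.exec, v20]
      · have := vit i hi
        simpa [execs, Instr.exec, Function.update_apply, register_ne] using this
      · have := vrow z hz
        simpa [execs, Instr.exec, Function.update_apply, register_ne] using this
  · rintro u ⟨_, _, h, _⟩
    omega
  · refine ⟨ha, fun _ _ => by rw [hag], a14, a15, by simp [a16], by simp [a17], by simp [a18], a20,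
      fun i hi => absurd hi (by omega), fun z hz => absurd hz (by omega)⟩
  · rintro u ⟨h1, h2, -, -, -, -, -, -, h3, h4⟩
    exact ⟨h1, h2, h3, fun y hy => h4 y (Nat.mul_lt_mul_of_pos_left hy (by omega))⟩

end GroupRAM

namespace GroupRAM

variable {G : Type*} [Group G]

/-- The constants, the multiples of `m` and the tables of `a` and `b` are in their places. -/
structure Ready (m Z : ℕ) (a b : ℕ → G) (s : State G) : Prop where
  num_two : s.num 2 = 1
  num_three : s.num 3 = m
  num_eleven : s.num 11 = Z
  num_twelve : s.num 12 = Z + 2 * (m * m)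
  num_zero : s.num 21 = 0
  num_stride : s.num 22 = 3
  num_base : s.num 25 = 42
  row : ∀ y < m, s.num (42 + 3 * y) = m * y
  left : ∀ k < m * m, s.grp (Z + k) = a k
  right : ∀ k < m * m, s.grp (Z + 2 * (m * m) + k) = b k

theorem Ready.frame {G : Type*} {m Z : ℕ} {a b : ℕ → G} {s s' : State G} (h : Ready m Z a b s)
    (hreg : ∀ j < 40, (j < 6 ∨ 6 < j ∧ j < 13 ∨ 20 < j ∧ j < 23 ∨ j = 25) → s'.num j = s.num j)
    (hrow : ∀ y, s'.num (42 + 3 * y) = s.num (42 + 3 * y))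
    (hgrp : ∀ j, Z ≤ j → s'.grp j = s.grp j) : Ready m Z a b s' := by
  constructor
  · rw [hreg 2 (by omega) (by omega), h.num_two]
  · rw [hreg 3 (by omega) (by omega), h.num_three]
  · rw [hreg 11 (by omega) (by omega), h.num_eleven]
  · rw [hreg 12 (by omega) (by omega), h.num_twelve]
  · rw [hreg 21 (by omega) (by omega), h.num_zero]
  · rw [hreg 22 (by omega) (by omega), h.num_stride]
  · rw [hreg 25 (by omega) (by omega), h.num_base]
  · intro y hy
    rw [hrow, h.row y hy]
  · intro k hk
    rw [hgrp _ (by omega), h.left k hk]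
  · intro k hk
    rw [hgrp _ (by omega), h.right k hk]

/-- The `i`-th stored item is `p`. -/
def ItemAt (m : ℕ) (s : State G) (i : ℕ) (p : (ZMod m × ZMod m) × G) : Prop :=
  s.num (40 + 3 * i) < m ∧ s.num (41 + 3 * i) < m ∧
    p = ((((s.num (40 + 3 * i) : ℕ) : ZMod m), ((s.num (41 + 3 * i) : ℕ) : ZMod m)), s.grp i)

/-- The stored items are those of the list `J`. -/
def Holds (m : ℕ) (s : State G) (J : List ((ZMod m × ZMod m) × G)) : Prop :=
  s.num 13 = J.length ∧ ∀ i p, J[i]? = some p → ItemAt m s i p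

/-- Append the image of the item at the address `num[15]` under `(x, y) ↦ (y, x + w)`, where `w` is
computed by the instruction `wi`. -/
def doubleBody (wi : Instr) : Program :=
  .seq (block [.load 17 15, .add 6 15 2, .load 18 6])
    (.seq (.instr wi) (.seq (block [.add 17 17 19, .sub 6 3 17, .sub 14 14 2])
      (.seq (.ite 6 (block [.const 6 0]) (block [.sub 17 17 3]))
        (block [.store 16 18, .add 6 16 2, .store 6 17, .one 23, .mul 23 20 23, .add 15 15 22,
          .add 16 16 22, .add 20 20 2, .add 23 23 2]))))

theorem haltsIn_doubleBody {u : State G} {m l k x y : ℕ} {wi : Instr} {c : ℕ → ℕ}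
    (hwi : ∀ s : State G, s.num 21 = 0 →
      wi.exec s = { s with num := Function.update s.num 19 (c (s.num 18)) })
    (hx : x < m) (hc : c y ≤ m) (u2 : u.num 2 = 1) (u3 : u.num 3 = m) (u21 : u.num 21 = 0)
    (u22 : u.num 22 = 3) (u15 : u.num 15 = 40 + 3 * k) (u16 : u.num 16 = 40 + 3 * (l + k))
    (u20 : u.num 20 = k) (u23 : u.num 23 = l + k) (hlk : k ≠ l + k)
    (ux : u.num (40 + 3 * k) = x) (uy : u.num (41 + 3 * k) = y) :
    HaltsIn (doubleBody wi) u 18 fun v =>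
      (∀ j < 40, (j < 6 ∨ 6 < j ∧ j < 14 ∨ 20 < j ∧ j < 23 ∨ j = 25) → v.num j = u.num j) ∧
      v.num 14 = u.num 14 - 1 ∧ v.num 15 = 40 + 3 * (k + 1) ∧
      v.num 16 = 40 + 3 * (l + (k + 1)) ∧ v.num 20 = k + 1 ∧ v.num 23 = l + (k + 1) ∧
      (∀ j, 40 ≤ j → v.num j = if j = 41 + 3 * (l + k) then (x + c y) % m else
        if j = 40 + 3 * (l + k) then y else u.num j) ∧
      v.grp = Function.update u.grp (l + k) (u.grp k) := by
  refine HaltsIn.mono (HaltsIn.seq (b := 3) (b' := 15) (Q := fun v =>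
    (∀ j, j ≠ 6 → j ≠ 17 → j ≠ 18 → v.num j = u.num j) ∧ v.num 17 = x ∧ v.num 18 = y ∧
      v.grp = u.grp) (haltsIn_block (by simp) ?_) ?_) (by omega) fun _ h => h
  · refine ⟨fun j h6 h17 h18 => ?_, ?_, ?_, ?_⟩
    all_goals simp [execs, Instr.exec, *, forty_add_add_one, register_ne]
  rintro v ⟨hv, v17, v18, vg⟩
  have v21 : v.num 21 = 0 := by rw [hv 21] <;> simp [u21]
  refine HaltsIn.seq (b := 1) (b' := 14) (Q := fun v =>
    (∀ j, j ≠ 6 → j ≠ 17 → j ≠ 18 → j ≠ 19 → v.num j = u.num j) ∧ v.num 17 = x ∧ v.num 18 = y ∧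
      v.num 19 = c y ∧ v.grp = u.grp) ⟨1, _, .instr wi v, le_rfl, ?_⟩ ?_
  · rw [hwi v v21]
    refine ⟨fun j h6 h17 h18 h19 => ?_, ?_, ?_, ?_, vg⟩
    · simp [h19, hv j h6 h17 h18]
    all_goals simp [v17, v18]
  clear hv v17 v18 vg v21 v
  rintro v ⟨hv, v17, v18, v19, vg⟩
  refine HaltsIn.seq (b := 3) (b' := 11) (Q := fun v =>
    (∀ j, j ≠ 6 → j ≠ 14 → j ≠ 17 → j ≠ 18 → j ≠ 19 → v.num j = u.num j) ∧ v.num 17 = x + c y ∧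
      v.num 18 = y ∧ v.num 6 = m - (x + c y) ∧ v.num 14 = u.num 14 - 1 ∧ v.grp = u.grp)
    (haltsIn_block (by simp) ?_) ?_
  · have v2 : v.num 2 = 1 := by rw [hv 2] <;> simp [u2]
    have v3 : v.num 3 = m := by rw [hv 3] <;> simp [u3]
    have v14 : v.num 14 = u.num 14 := by rw [hv 14] <;> simp
    refine ⟨fun j h6 h14 h17 h18 h19 => ?_, ?_, ?_, ?_, ?_, ?_⟩
    · simp [execs, Instr.exec, h6, h14, h17, hv j h6 h17 h18 h19]
    all_goals simp [execs, Instr.exec, v2, v3, v14, v17, v18, v19, vg]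
  clear hv v17 v18 v19 vg v
  rintro v ⟨hv, v17, v18, v6, v14, vg⟩
  refine HaltsIn.seq (b := 2) (b' := 9) (Q := fun v =>
    (∀ j, j ≠ 6 → j ≠ 14 → j ≠ 17 → j ≠ 18 → j ≠ 19 → v.num j = u.num j) ∧
      v.num 17 = (x + c y) % m ∧ v.num 18 = y ∧ v.num 14 = u.num 14 - 1 ∧ v.grp = u.grp)
    (HaltsIn.ite (b := 1) (fun h => haltsIn_block (by simp) ?_)
      fun h => haltsIn_block (by simp) ?_) ?_
  · refine ⟨fun j h6 h14 h17 h18 h19 => ?_, ?_, ?_, ?_, ?_⟩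
    · simp [execs, Instr.exec, h6, hv j h6 h14 h17 h18 h19]
    · simp only [execs, Instr.exec, List.foldl_cons, List.foldl_nil]
      rw [Function.update_of_ne (by omega), v17, Nat.mod_eq_of_lt (by omega)]
    all_goals simp [execs, Instr.exec, v14, v18, vg]
  · have v3 : v.num 3 = m := by rw [hv 3] <;> simp [u3]
    refine ⟨fun j h6 h14 h17 h18 h19 => ?_, ?_, ?_, ?_, ?_⟩
    · simp [execs, Instr.exec, h17, hv j h6 h14 h17 h18 h19]
    · simp only [execs, Instr.exec, List.foldl_cons, List.foldl_nil]
      rw [Function.update_self, v17, v3, Nat.mod_eq_sub_mod (by omega),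
        Nat.mod_eq_of_lt (by omega)]
    all_goals simp [execs, Instr.exec, v14, v18, vg]
  clear hv v17 v18 v14 vg v6 v
  rintro v ⟨hv, v17, v18, v14, vg⟩
  have v2 : v.num 2 = 1 := by rw [hv 2] <;> simp [u2]
  have v22 : v.num 22 = 3 := by rw [hv 22] <;> simp [u22]
  have v15 : v.num 15 = 40 + 3 * k := by rw [hv 15] <;> simp [u15]
  have v16 : v.num 16 = 40 + 3 * (l + k) := by rw [hv 16] <;> simp [u16]
  have v20 : v.num 20 = k := by rw [hv 20] <;> simp [u20]
  have v23 : v.num 23 = l + k := by rw [hv 23] <;> simp [u23]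
  refine haltsIn_block (by simp) ⟨fun j hj h => ?_, ?_, ?_, ?_, ?_, ?_, fun j hj => ?_, ?_⟩
  · have : j ≠ 6 ∧ j ≠ 14 ∧ j ≠ 15 ∧ j ≠ 16 ∧ j ≠ 17 ∧ j ≠ 18 ∧ j ≠ 19 ∧ j ≠ 20 ∧ j ≠ 23 := by
      omega
    simp [execs, Instr.exec, v2, v16, this, hj, register_ne, forty_add_add_one, hv j]
  · simp [execs, Instr.exec, v2, v14, v16, register_ne, forty_add_add_one]
  · simp [execs, Instr.exec, v2, v15, v16, v22, register_ne, forty_add_add_one]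
    omega
  · simp [execs, Instr.exec, v2, v16, v22, register_ne, forty_add_add_one]
    omega
  · simp [execs, Instr.exec, v2, v16, v20, register_ne, forty_add_add_one]
  · simp [execs, Instr.exec, v2, v16, v23, register_ne, forty_add_add_one]
    omega
  · have : j ≠ 6 ∧ j ≠ 14 ∧ j ≠ 15 ∧ j ≠ 16 ∧ j ≠ 17 ∧ j ≠ 18 ∧ j ≠ 19 ∧ j ≠ 20 ∧ j ≠ 23 := by
      omega
    simp [execs, Instr.exec, Function.update_apply, v2, v16, v17, v18, this, register_ne,
      forty_add_add_one, hv j]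
  · simp [execs, Instr.exec, v2, v16, v20, v23, register_ne, forty_add_add_one, vg]
    rw [Function.update_of_ne hlk]

/-- Replace the list of items `J` by `doubleItems T J`. -/
def doubleCode (wi : Instr) : Program :=
  .seq (block [.add 14 13 21, .const 15 40, .add 16 13 13, .add 16 16 13, .add 16 16 15,
      .const 20 0, .add 23 13 21])
    (.seq (.loop 14 (doubleBody wi)) (.instr (.add 13 13 13)))

theorem haltsIn_doubleCode {s : State G} {m Z : ℕ} {a b : ℕ → G} {wi : Instr} {c : ℕ → ℕ}
    {w : ZMod m → ZMod m}
    (hwi : ∀ s : State G, s.num 21 = 0 →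
      wi.exec s = { s with num := Function.update s.num 19 (c (s.num 18)) })
    (hc : ∀ y < m, c y ≤ m) (hcw : ∀ y, ((c y : ℕ) : ZMod m) = w y) (hs : Ready m Z a b s)
    {J : List ((ZMod m × ZMod m) × G)} (hJ : Holds m s J) (hZ : J.length * 2 ≤ Z) :
    HaltsIn (doubleCode wi) s (J.length * 19 + 9) fun s' =>
      Ready m Z a b s' ∧ Holds m s' (doubleItems (torusStep w) J) := by
  set l := J.length with hl
  refine HaltsIn.mono (HaltsIn.seq (b := 7) (b' := l * (18 + 1) + 1 + 1) (Q := fun u =>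
      (∀ j, (j < 14 ∨ 23 < j ∨ j = 21 ∨ j = 22) → u.num j = s.num j) ∧ u.grp = s.grp ∧
      u.num 14 = l ∧ u.num 15 = 40 ∧ u.num 16 = 40 + 3 * l ∧ u.num 20 = 0 ∧ u.num 23 = l)
    (haltsIn_block (by simp) ?_) ?_) (by omega) fun _ h => h
  · have s13 := hJ.1
    have s21 := hs.num_zero
    refine ⟨fun j hj => ?_, rfl, ?_, ?_, ?_, ?_, ?_⟩
    · have : j ≠ 14 ∧ j ≠ 15 ∧ j ≠ 16 ∧ j ≠ 20 ∧ j ≠ 23 := by omega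
      simp [execs, Instr.exec, this]
    all_goals simp [execs, Instr.exec, s13, s21, ← hl]
    omega
  rintro t ⟨ht, htg, t14, t15, t16, t20, t23⟩
  refine HaltsIn.seq (HaltsIn.loop (n := l) (b := 18) (I := fun k u =>
      (∀ j < 40, (j < 6 ∨ 6 < j ∧ j < 14 ∨ 20 < j ∧ j < 23 ∨ j = 25) → u.num j = s.num j) ∧
      (∀ y, u.num (42 + 3 * y) = s.num (42 + 3 * y)) ∧ (∀ j, Z ≤ j → u.grp j = s.grp j) ∧
      u.num 14 = l - k ∧ u.num 15 = 40 + 3 * k ∧ u.num 16 = 40 + 3 * (l + k) ∧ u.num 20 = k ∧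
      u.num 23 = l + k ∧ ∀ i p, (doubleItems (torusStep w) J)[i]? = some p → i < l + k →
        ItemAt m u i p) ?_ ?_ ?_) ?_
  · rintro k hk u ⟨hu, urow, ug, u14, u15, u16, u20, u23, uit⟩
    have hr : Ready m Z a b u := hs.frame (fun j hj h => hu j hj (by omega)) urow ug
    refine ⟨by omega, ?_⟩
    have hkJ : (doubleItems (torusStep w) J)[k]? = some J[k] := by
      rw [doubleItems, List.getElem?_append_left hk, List.getElem?_eq_getElem hk]
    have hkJ' : (doubleItems (torusStep w) J)[l + k]? = some (torusStep w J[k].1, J[k].2) := by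
      rw [doubleItems, List.getElem?_append_right (by omega), hl, Nat.add_sub_cancel_left,
        List.getElem?_map, List.getElem?_eq_getElem hk]
      rfl
    obtain ⟨hx, hy, hp⟩ := uit k _ hkJ (by omega)
    set x := u.num (40 + 3 * k) with hxdef
    set y := u.num (41 + 3 * k) with hydef
    refine (haltsIn_doubleBody hwi hx (hc y hy) hr.num_two hr.num_three hr.num_zero hr.num_stride
      u15 u16 u20 u23 (by omega) rfl rfl).mono le_rfl ?_
    rintro v ⟨hv, v14, v15, v16, v20, v23, vnum, vg⟩
    refine ⟨fun j hj h => by rw [hv j hj h, hu j hj h], fun z => ?_, fun j hj => ?_, by omega,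
      v15, v16, v20, v23, fun i p hip hi => ?_⟩
    · rw [vnum _ (by omega), if_neg (by omega), if_neg (by omega), urow]
    · rw [vg, Function.update_of_ne (by omega), ug j hj]
    · by_cases hik : i = l + k
      · subst hik
        rw [hkJ'] at hip
        obtain rfl := Option.some.inj hip
        have e1 : v.num (40 + 3 * (l + k)) = y := by
          rw [vnum _ (by omega), if_neg (by omega), if_pos rfl]
        have e2 : v.num (41 + 3 * (l + k)) = (x + c y) % m := by
          rw [vnum _ (by omega), if_pos rfl]
        refine ⟨by rw [e1]; exact hy, by rw [e2]; exact Nat.mod_lt _ (by omega), ?_⟩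
        rw [e1, e2, vg, Function.update_self, hp]
        simp [torusStep, hcw]
      · have e1 : v.num (40 + 3 * i) = u.num (40 + 3 * i) := by
          rw [vnum _ (by omega), if_neg (by omega), if_neg (by omega)]
        have e2 : v.num (41 + 3 * i) = u.num (41 + 3 * i) := by
          rw [vnum _ (by omega), if_neg (by omega), if_neg (by omega)]
        have := uit i p hip (by omega)
        rw [ItemAt] at this ⊢
        rwa [e1, e2, vg, Function.update_of_ne hik]
  · rintro u ⟨-, -, -, h, -⟩
    omega
  · refine ⟨fun j hj h => ht j (by omega), fun y => ht _ (by omega), fun j _ => by rw [htg],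
      by omega, t15, t16, t20, t23, fun i p hip hi => ?_⟩
    rw [doubleItems, List.getElem?_append_left (by omega)] at hip
    have := hJ.2 i p hip
    rw [ItemAt] at this ⊢
    rwa [htg, ht _ (by omega), ht _ (by omega)]
  · rintro u ⟨hu, urow, ug, -, -, -, -, -, uit⟩
    refine ⟨1, _, .instr _ u, le_rfl, ?_⟩
    have frame : ∀ j, j ≠ 13 → (Instr.exec u (.add 13 13 13)).num j = u.num j := by
      intro j hj
      simp [Instr.exec, hj]
    refine ⟨hs.frame (fun j hj h => ?_) (fun y => ?_) ug, ?_, fun i p hip => ?_⟩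
    · rw [frame j (by omega), hu j hj (by omega)]
    · rw [frame _ (by omega), urow]
    · have u13 : u.num 13 = l := by rw [hu 13 (by omega) (by omega), hJ.1]
      rw [length_doubleItems]
      simp [Instr.exec, u13, ← hl]
      omega
    · have hlt : i < l + l := by
        have := (List.getElem?_eq_some_iff.1 hip).1
        rw [length_doubleItems] at this
        omega
      have := uit i p hip hlt
      rw [ItemAt] at this ⊢
      rwa [frame _ (by omega), frame _ (by omega)]

/-- Multiply every item by the entry of its vertex in the table at the address `num[off]`. -/
def mulCode (off : ℕ) : Program :=
  .seq (block [.add 14 13 21, .const 15 40, .const 20 0])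
    (.loop 14 (block [.load 17 15, .add 6 15 2, .load 18 6, .add 6 18 18, .add 6 6 18, .add 6 25 6,
      .load 6 6, .add 6 6 17, .add 6 off 6, .mul 20 20 6, .add 15 15 22, .add 20 20 2,
      .sub 14 14 2]))

theorem haltsIn_mulCode {s : State G} {m Z : ℕ} {a b d : ℕ → G} {off O : ℕ}
    (hs : Ready m Z a b s) (hoff : off = 11 ∨ off = 12) (hO : s.num off = O) (hZO : Z ≤ O)
    (hd : ∀ k < m * m, s.grp (O + k) = d k) {J : List ((ZMod m × ZMod m) × G)} (hJ : Holds m s J)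
    (hZ : J.length ≤ Z) :
    HaltsIn (mulCode off) s (J.length * 14 + 4) fun s' =>
      Ready m Z a b s' ∧ Holds m s' (mulItems (fun v => d (torusIndex v)) J) := by
  set l := J.length with hl
  refine HaltsIn.mono (HaltsIn.seq (b := 3) (b' := l * (13 + 1) + 1) (Q := fun u =>
      (∀ j, (j < 14 ∨ 20 < j) → u.num j = s.num j) ∧ u.grp = s.grp ∧
      u.num 14 = l ∧ u.num 15 = 40 ∧ u.num 20 = 0)
    (haltsIn_block (by simp) ?_) ?_) (by omega) fun _ h => h
  · have s13 := hJ.1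
    have s21 := hs.num_zero
    refine ⟨fun j hj => ?_, rfl, ?_, ?_, ?_⟩
    · have : j ≠ 14 ∧ j ≠ 15 ∧ j ≠ 20 := by omega
      simp [execs, Instr.exec, this]
    all_goals simp [execs, Instr.exec, s13, s21, ← hl]
  rintro t ⟨ht, htg, t14, t15, t20⟩
  refine (HaltsIn.loop (n := l) (b := 13) (I := fun k u =>
      (∀ j, j ≠ 6 → (j < 14 ∨ 20 < j) → u.num j = s.num j) ∧ (∀ j, k ≤ j → u.grp j = s.grp j) ∧
      u.num 14 = l - k ∧ u.num 15 = 40 + 3 * k ∧ u.num 20 = k ∧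
      ∀ i p, (mulItems (fun v => d (torusIndex v)) J)[i]? = some p → i < k → ItemAt m u i p)
    ?_ ?_ ?_).mono le_rfl ?_
  · rintro k hk u ⟨hu, ug, u14, u15, u20, uit⟩
    obtain ⟨hx, hy, hp⟩ := hJ.2 k J[k] (List.getElem?_eq_getElem hk)
    set x := s.num (40 + 3 * k) with hxdef
    set y := s.num (41 + 3 * k) with hydef
    have u2 : u.num 2 = 1 := by rw [hu 2 (by omega) (by omega), hs.num_two]
    have u22 : u.num 22 = 3 := by rw [hu 22 (by omega) (by omega), hs.num_stride]
    have u25 : u.num 25 = 42 := by rw [hu 25 (by omega) (by omega), hs.num_base]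
    have uoff : u.num off = O := by rw [hu off (by omega) (by omega), hO]
    have ux : u.num (40 + 3 * k) = x := hu _ (by omega) (by omega)
    have uy : u.num (41 + 3 * k) = y := hu _ (by omega) (by omega)
    have urow : u.num (42 + (y + y + y)) = m * y := by
      rw [hu _ (by omega) (by omega), show y + y + y = 3 * y by ring, hs.row y hy]
    have hoff' : off ≠ 6 ∧ off ≠ 17 ∧ off ≠ 18 := by omega
    refine ⟨by omega, haltsIn_block (by simp) ⟨fun j h6 hj => ?_, fun j hj => ?_, ?_, ?_, ?_,
      fun i p hip hi => ?_⟩⟩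
    · have : j ≠ 14 ∧ j ≠ 15 ∧ j ≠ 17 ∧ j ≠ 18 ∧ j ≠ 20 := by omega
      simp [execs, Instr.exec, this, h6, hu j h6 hj]
    · have : j ≠ k := by omega
      simp [execs, Instr.exec, u20, this, ug j (by omega)]
    · simp [execs, Instr.exec, u14, u2]
      omega
    · simp [execs, Instr.exec, u15, u22]
      omega
    · simp [execs, Instr.exec, u20, u2]
    · have hnum : ∀ j, 40 ≤ j → (execs [.load 17 15, .add 6 15 2, .load 18 6, .add 6 18 18,
          .add 6 6 18, .add 6 25 6, .load 6 6, .add 6 6 17, .add 6 off 6, .mul 20 20 6,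
          .add 15 15 22, .add 20 20 2, .sub 14 14 2] u).num j = u.num j := by
        intro j hj
        have : j ≠ 6 ∧ j ≠ 14 ∧ j ≠ 15 ∧ j ≠ 17 ∧ j ≠ 18 ∧ j ≠ 20 := by omega
        simp [execs, Instr.exec, this]
      have hgrp : (execs [.load 17 15, .add 6 15 2, .load 18 6, .add 6 18 18,
          .add 6 6 18, .add 6 25 6, .load 6 6, .add 6 6 17, .add 6 off 6, .mul 20 20 6,
          .add 15 15 22, .add 20 20 2, .sub 14 14 2] u).grp =
          Function.update u.grp k (u.grp k * u.grp (O + (m * y + x))) := by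
        simp [execs, Instr.exec, u2, u15, u20, u25, uoff, ux, uy, urow, hoff', register_ne,
          forty_add_add_one]
      rw [ItemAt, hnum _ (by omega), hnum _ (by omega), hgrp]
      by_cases hik : i = k
      · subst hik
        rw [ux, uy, Function.update_self, ug i le_rfl, ug _ (by omega)]
        refine ⟨hx, hy, ?_⟩
        rw [mulItems, List.getElem?_map, List.getElem?_eq_getElem hk, Option.map_some] at hip
        rw [← Option.some.inj hip, hp]
        have hidx : torusIndex (((x : ℕ) : ZMod m), ((y : ℕ) : ZMod m)) = m * y + x := by
          rw [torusIndex, ZMod.val_natCast, ZMod.val_natCast, Nat.mod_eq_of_lt hx,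
            Nat.mod_eq_of_lt hy, add_comm]
        rw [hidx, hd _ (by nlinarith)]
      · rw [Function.update_of_ne hik]
        exact uit i p hip (by omega)
  · rintro u ⟨-, -, h, -⟩
    omega
  · exact ⟨fun j _ hj => ht j hj, fun j _ => by rw [htg], by omega, t15, t20,
      fun i p _ hi => absurd hi (by omega)⟩
  · rintro u ⟨hu, ug, -, -, -, uit⟩
    have hlen : (mulItems (fun v => d (torusIndex v)) J).length = l := by simp [mulItems, hl]
    refine ⟨hs.frame (fun j _ h => hu j (by omega) (by omega))
      (fun y => hu _ (by omega) (by omega)) fun j hj => ug j (by omega), ?_, fun i p hip => ?_⟩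
    · rw [hlen, hu 13 (by omega) (by omega), hJ.1]
    · refine uit i p hip ?_
      have := (List.getElem?_eq_some_iff.1 hip).1
      omega

end GroupRAM

namespace GroupRAM

variable {G : Type*} [Group G]

/-- Replace the list of items `J` by `mixItems m J`. -/
def mixCode : Program :=
  .seq (doubleCode (.add 19 18 21)) (.seq (doubleCode (.const 19 0)) (doubleCode (.const 19 1)))

theorem haltsIn_mixCode {s : State G} {m Z : ℕ} {a b : ℕ → G} (hs : Ready m Z a b s)
    {J : List ((ZMod m × ZMod m) × G)} (hJ : Holds m s J) (hZ : J.length * 8 ≤ Z) :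
    HaltsIn mixCode s (20 * Z + 27) fun s' => Ready m Z a b s' ∧ Holds m s' (mixItems m J) := by
  have h1 := haltsIn_doubleCode (wi := .add 19 18 21) (c := id) (w := id)
    (fun s h => by simp [Instr.exec, h]) (fun y hy => hy.le)
    (fun y => rfl) hs hJ (by omega)
  refine HaltsIn.mono (HaltsIn.seq h1 (b' := J.length * 38 + 9 + (J.length * 76 + 9))
    fun s₁ ⟨hs₁, hJ₁⟩ => ?_) (by omega) fun _ h => h
  have h2 := haltsIn_doubleCode (wi := .const 19 0) (c := fun _ => 0) (w := fun _ => 0)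
    (fun s _ => rfl) (fun y _ => Nat.zero_le _) (fun y => by simp) hs₁ hJ₁
    (by rw [length_doubleItems]; omega)
  refine HaltsIn.seq (h2.mono (by rw [length_doubleItems]; omega) fun _ h => h)
    fun s₂ ⟨hs₂, hJ₂⟩ => ?_
  have h3 := haltsIn_doubleCode (wi := .const 19 1) (c := fun _ => 1) (w := fun _ => 1)
    (fun s _ => rfl) (fun y hy => by omega) (fun y => by simp) hs₂ hJ₂
    (by rw [length_doubleItems, length_doubleItems]; omega)
  exact h3.mono (by rw [length_doubleItems, length_doubleItems]; omega) fun _ h => h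

/-- Run a program `r` times. -/
def repeatCode (p : Program) : ℕ → Program
  | 0 => .instr (.const 6 0)
  | r + 1 => .seq p (repeatCode p r)

theorem haltsIn_repeat_mixCode {m Z : ℕ} {a b : ℕ → G} (r : ℕ) {s : State G}
    (hs : Ready m Z a b s) {J : List ((ZMod m × ZMod m) × G)} (hJ : Holds m s J)
    (hZ : J.length * 8 ^ r ≤ Z) :
    HaltsIn (repeatCode mixCode r) s (r * (20 * Z + 27) + 1) fun s' =>
      Ready m Z a b s' ∧ Holds m s' ((mixItems m)^[r] J) := by
  induction r generalizing s J with
  | zero =>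
    refine ⟨1, _, .instr _ s, by omega, ?_⟩
    have frame : ∀ j, j ≠ 6 → (Instr.exec s (.const 6 0)).num j = s.num j := by
      intro j hj
      simp [Instr.exec, hj]
    refine ⟨hs.frame (fun j _ h => frame j (by omega)) (fun y => frame _ (by omega))
      fun _ _ => rfl, ?_, fun i p hip => ?_⟩
    · rw [frame 13 (by omega)]
      exact hJ.1
    · have := hJ.2 i p hip
      rw [ItemAt] at this ⊢
      rwa [frame _ (by omega), frame _ (by omega)]
  | succ r ih =>
    have h8 : 1 ≤ 8 ^ r := Nat.one_le_pow _ _ (by norm_num)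
    have hlen : (mixItems m J).length = J.length * 8 := by
      simpa using length_mixItems_iterate 1 J
    have h1 : J.length * 8 * 8 ^ r ≤ Z := by
      rw [pow_succ] at hZ
      calc _ = J.length * (8 ^ r * 8) := by ring
        _ ≤ Z := hZ
    have h2 : J.length * 8 ≤ Z := (Nat.le_mul_of_pos_right _ h8).trans h1
    refine HaltsIn.mono (HaltsIn.seq (haltsIn_mixCode hs hJ h2) fun s' ⟨hs', hJ'⟩ =>
      ih hs' hJ' (by rw [hlen]; exact h1)) ?_ fun _ h => h
    rw [add_mul]
    omega

/-- Prepare the constants, the tables and the initial items. -/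
def setupCode (r : ℕ) : Program :=
  .seq (block [.const 2 1, .const 22 3, .const 25 42, .add 5 0 1, .add 5 5 5, .add 5 5 5,
      .add 5 5 5, .add 5 5 5, .add 5 5 5, .add 5 5 5, .add 6 5 21])
    (.seq sqrtCode (.seq (.instr (.add 7 4 21)) (.seq (repeatCode (.instr (.add 7 7 7)) (9 * r))
      (.seq (block [.add 11 7 21, .add 12 7 4, .add 12 12 4]) (.seq (tableCode 21 11 0)
        (.seq (tableCode 0 12 1) (.seq initCode (.instr (.add 13 4 21)))))))))

theorem haltsIn_repeat_double (k : ℕ) (s : State G) :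
    HaltsIn (repeatCode (.instr (.add 7 7 7)) k) s (k + 1) fun s' =>
      (∀ j, j ≠ 6 → j ≠ 7 → s'.num j = s.num j) ∧ s'.num 7 = s.num 7 * 2 ^ k ∧
        s'.grp = s.grp := by
  induction k generalizing s with
  | zero =>
    refine ⟨1, _, .instr _ s, le_rfl, fun j h6 h7 => ?_, ?_, rfl⟩
    all_goals simp [Instr.exec, *]
  | succ k ih =>
    obtain ⟨t, s', hr, ht, h1, h2, h3⟩ := ih (Instr.exec s (.add 7 7 7))
    refine ⟨1 + t, s', .seq (.instr _ s) hr, by omega, fun j h6 h7 => ?_, ?_, h3⟩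
    · rw [h1 j h6 h7]
      simp [Instr.exec, h7]
    · rw [h2, pow_succ]
      simp [Instr.exec]
      ring

theorem haltsIn_setupCode (r : ℕ) (A B : List G) :
    ∃ m, 64 * (A.length + B.length) ≤ m * m ∧ m * m ≤ 256 * (A.length + B.length) ∧
      HaltsIn (setupCode r) (input A B) (37 * (m * m) + 9 * r + 60) fun s =>
        Ready m (m * m * (8 ^ r * 8 ^ r * 8 ^ r)) (altSeq A) (altSeq B) s ∧
          Holds m s (startItems m G) := by
  set s₀ := input A B with hs₀
  have z0 : s₀.num 0 = A.length := rfl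
  have z1 : s₀.num 1 = B.length := rfl
  have zz : ∀ j, 2 ≤ j → s₀.num j = 0 := by
    intro j hj
    simp [hs₀, input, show j ≠ 0 by omega, show j ≠ 1 by omega]
  obtain ⟨s₁, hs₁⟩ : ∃ s₁, s₁ = execs [.const 2 1, .const 22 3, .const 25 42, .add 5 0 1,
      .add 5 5 5, .add 5 5 5, .add 5 5 5, .add 5 5 5, .add 5 5 5, .add 5 5 5, .add 6 5 21] s₀ :=
    ⟨_, rfl⟩
  have g1 : s₁.grp = s₀.grp := by rw [hs₁]; rfl
  have a0 : s₁.num 0 = A.length := by simp [hs₁, execs, Instr.exec, z0]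
  have a1 : s₁.num 1 = B.length := by simp [hs₁, execs, Instr.exec, z1]
  have a2 : s₁.num 2 = 1 := by simp [hs₁, execs, Instr.exec]
  have a3 : s₁.num 3 = 0 := by simp [hs₁, execs, Instr.exec, zz]
  have a4 : s₁.num 4 = 0 := by simp [hs₁, execs, Instr.exec, zz]
  have a5 : s₁.num 5 = 64 * (A.length + B.length) := by
    simp [hs₁, execs, Instr.exec, z0, z1]
    ring
  have a6 : s₁.num 6 = s₁.num 5 := by simp [hs₁, execs, Instr.exec, zz]
  have a21 : s₁.num 21 = 0 := by simp [hs₁, execs, Instr.exec, zz]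
  have a22 : s₁.num 22 = 3 := by simp [hs₁, execs, Instr.exec]
  have a25 : s₁.num 25 = 42 := by simp [hs₁, execs, Instr.exec]
  obtain ⟨m, hm1, hm2, hsqrt⟩ := haltsIn_sqrtCode a2 a3 a4 a6
  rw [a5] at hm1 hm2
  refine ⟨m, hm1, by omega, ?_⟩
  set n := m * m with hn
  set E := 8 ^ r * 8 ^ r * 8 ^ r with hE
  have hE1 : 1 ≤ E := Nat.one_le_iff_ne_zero.2 (by positivity)
  have hE2 : 2 ^ (9 * r) = E := by
    rw [hE, show (8 : ℕ) = 2 ^ 3 by norm_num, ← pow_mul, ← pow_add, ← pow_add]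
    congr 1
    ring
  have hnZ : n ≤ n * E := Nat.le_mul_of_pos_right _ hE1
  have hmn : m ≤ n := Nat.le_mul_self m
  set Z := n * E with hZ
  refine HaltsIn.mono (HaltsIn.seq (b' := 5 * n + 1 + (1 + (9 * r + 1 + (3 +
    (A.length * 5 + n * 5 + 7 + (B.length * 5 + n * 5 + 7 + (n * 16 + 7 + 1)))))))
    (haltsIn_block (by simp) (Q := fun s => s = s₁) hs₁.symm) ?_)
    (by simp only [List.length_cons, List.length_nil]; omega) fun _ h => h
  intro s hs
  rw [hs]
  refine HaltsIn.seq (hsqrt.mono (by omega) fun _ h => h) ?_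
  rintro s₂ ⟨h2, g2, c3, c4⟩
  refine HaltsIn.seq (b := 1) (Q := fun s => s = Instr.exec s₂ (.add 7 4 21))
    ⟨1, _, .instr _ _, le_rfl, rfl⟩ ?_
  rintro _ rfl
  refine HaltsIn.seq (haltsIn_repeat_double (9 * r) _) ?_
  rintro s₃ ⟨h3, d7, g3⟩
  have h3' : ∀ j, j ≠ 3 → j ≠ 4 → j ≠ 6 → j ≠ 7 → s₃.num j = s₁.num j := by
    intro j p3 p4 p6 p7
    rw [h3 j p6 p7, ← h2 j p3 p4 p6]
    simp [Instr.exec, p7]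
  have d3 : s₃.num 3 = m := by rw [h3 3 (by omega) (by omega)]; simp [Instr.exec, c3]
  have d4 : s₃.num 4 = n := by rw [h3 4 (by omega) (by omega)]; simp [Instr.exec, c4, hn]
  have c21 : s₂.num 21 = 0 := by rw [h2 21 (by omega) (by omega) (by omega), a21]
  have d7' : s₃.num 7 = Z := by rw [d7, hE2]; simp [Instr.exec, c4, c21, hZ, hn]
  have d21 : s₃.num 21 = 0 := by rw [h3' 21 (by omega) (by omega) (by omega) (by omega), a21]
  have g3' : s₃.grp = s₀.grp := by rw [g3]; simp only [Instr.exec]; rw [g2, g1]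
  refine HaltsIn.seq (b := 3) (Q := fun s => (∀ j, j ≠ 3 → j ≠ 4 → j ≠ 6 → j ≠ 7 → j ≠ 11 →
      j ≠ 12 → s.num j = s₁.num j) ∧ s.num 3 = m ∧ s.num 4 = n ∧ s.num 11 = Z ∧
      s.num 12 = Z + 2 * n ∧ s.grp = s₀.grp) (haltsIn_block (by simp) ?_) ?_
  · refine ⟨fun j p3 p4 p6 p7 p11 p12 => ?_, ?_, ?_, ?_, ?_, ?_⟩
    · simp [execs, Instr.exec, p11, p12, h3' j p3 p4 p6 p7]
    all_goals simp [execs, Instr.exec, d3, d4, d7', d21, g3']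
    omega
  rintro s₄ ⟨h4, e3, e4, e11, e12, g4⟩
  have e0 : s₄.num 0 = A.length := by rw [h4 0] <;> simp [a0]
  have e1 : s₄.num 1 = B.length := by rw [h4 1] <;> simp [a1]
  have e2 : s₄.num 2 = 1 := by rw [h4 2] <;> simp [a2]
  have e21 : s₄.num 21 = 0 := by rw [h4 21] <;> simp [a21]
  have e22 : s₄.num 22 = 3 := by rw [h4 22] <;> simp [a22]
  have e25 : s₄.num 25 = 42 := by rw [h4 25] <;> simp [a25]
  have inA : ∀ k < A.length, s₀.grp k = A.getD k 1 := by
    intro k hk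
    simp [hs₀, input, List.getElem?_append_left hk]
  have inB : ∀ k < B.length, s₀.grp (A.length + k) = B.getD k 1 := by
    intro k hk
    simp [hs₀, input, List.getElem?_append_right]
  have inOne : ∀ k, A.length + B.length ≤ k → s₀.grp k = 1 := by
    intro k hk
    simp only [hs₀, input]
    rw [List.getD_eq_default _ _ (by simpa using hk)]
  have hA := haltsIn_tableCode (src := 21) (dst := 11) (len := 0) e2 e21 (by omega) (by omega) e0
    (by intro k hk; rw [e21, zero_add, g4, inA k hk]) (by rw [e21, e11]; omega)
    (by intro j hj _; rw [e11] at hj; rw [g4]; exact inOne j (by omega))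
  rw [e11, e4] at hA
  refine HaltsIn.seq hA ?_
  rintro s₅ ⟨h5, g5, tA⟩
  have f0 : s₅.num 0 = A.length := by rw [h5 0] <;> simp [e0]
  have f1 : s₅.num 1 = B.length := by rw [h5 1] <;> simp [e1]
  have f2 : s₅.num 2 = 1 := by rw [h5 2] <;> simp [e2]
  have f4 : s₅.num 4 = n := by rw [h5 4] <;> simp [e4]
  have f12 : s₅.num 12 = Z + 2 * n := by rw [h5 12] <;> simp [e12]
  have f21 : s₅.num 21 = 0 := by rw [h5 21] <;> simp [e21]
  have hB := haltsIn_tableCode (src := 0) (dst := 12) (len := 1) f2 f21 (by omega) (by omega) f1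
    (by intro k hk; rw [f0, g5 _ (by omega), g4, inB k hk]) (by rw [f0, f12]; omega)
    (by intro j hj _; rw [f12] at hj; rw [g5 _ (by omega), g4]; exact inOne j (by omega))
  rw [f12, f4] at hB
  refine HaltsIn.seq hB ?_
  rintro s₆ ⟨h6, g6, tB⟩
  have h6' : ∀ j, j ≠ 8 → j ≠ 9 → j ≠ 10 → s₆.num j = s₄.num j := by
    intro j p8 p9 p10
    rw [h6 j p8 p9 p10, h5 j p8 p9 p10]
  refine HaltsIn.seq (haltsIn_initCode (s := s₆) (m := m) (by rw [h6' 2] <;> simp [e2])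
    (by rw [h6' 3] <;> simp [e3]) (by rw [h6' 4] <;> simp [e4, hn])
    (by rw [h6' 21] <;> simp [e21]) (by rw [h6' 22] <;> simp [e22])) ?_
  rintro s₇ ⟨h7, g7, items, rows⟩
  have h7' : ∀ j < 40, j ≠ 6 → j ≠ 8 → j ≠ 9 → j ≠ 10 → (j < 14 ∨ 20 < j) →
      s₇.num j = s₄.num j := by
    intro j hj p6 p8 p9 p10 h
    rw [h7 j hj p6 h, h6' j p8 p9 p10]
  refine ⟨1, _, .instr _ s₇, le_rfl, ?_⟩
  have q4 : s₇.num 4 = n := by rw [h7' 4] <;> simp [e4]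
  have q21 : s₇.num 21 = 0 := by rw [h7' 21] <;> simp [e21]
  have frame : ∀ j, j ≠ 13 → (Instr.exec s₇ (.add 13 4 21)).num j = s₇.num j := by
    intro j hj
    simp [Instr.exec, hj]
  refine ⟨⟨?_, ?_, ?_, ?_, ?_, ?_, ?_, fun y hy => ?_, fun k hk => ?_, fun k hk => ?_⟩, ?_,
    fun i p hip => ?_⟩
  · rw [frame, h7' 2] <;> simp [e2]
  · rw [frame, h7' 3] <;> simp [e3]
  · rw [frame, h7' 11] <;> simp [e11]
  · rw [frame, h7' 12] <;> simp [e12, hn]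
  · rw [frame, q21]; simp
  · rw [frame, h7' 22] <;> simp [e22]
  · rw [frame, h7' 25] <;> simp [e25]
  · rw [frame _ (by omega), rows y hy]
  · change s₇.grp (Z + k) = _
    rw [g7 _ (by omega), g6 _ (by omega), tA k hk]
  · change s₇.grp (Z + 2 * n + k) = _
    rw [g7 _ (by omega), tB k hk]
  · simp [Instr.exec, q4, q21, startItems, hn]
  · have hi : i < m * m := by
      have := (List.getElem?_eq_some_iff.1 hip).1
      simpa [startItems] using this
    have hm0 : 0 < m := Nat.pos_of_ne_zero fun h => by simp [h] at hi
    obtain ⟨p1, p2, p3⟩ := items i hi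
    rw [ItemAt, frame _ (by omega), frame _ (by omega), p1, p2]
    refine ⟨Nat.mod_lt _ hm0, Nat.div_lt_of_lt_mul hi, ?_⟩
    change p = (_, s₇.grp i)
    rw [p3]
    simp only [startItems, List.getElem?_map, List.getElem?_range hi, Option.map_some,
      Option.some.injEq] at hip
    exact hip.symm

/-- The alternating walk on the prepared items. -/
def walkCode (r : ℕ) : Program :=
  .seq (mulCode 11) (.seq (repeatCode mixCode r) (.seq (mulCode 12) (.seq (repeatCode mixCode r)
    (.seq (mulCode 11) (.seq (repeatCode mixCode r) (mulCode 12))))))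

theorem haltsIn_walkCode {m r Z : ℕ} {a b : ℕ → G} {s : State G} (hs : Ready m Z a b s)
    (hJ : Holds m s (startItems m G)) (hZ : Z = m * m * (8 ^ r * 8 ^ r * 8 ^ r)) :
    HaltsIn (walkCode r) s (56 * Z + 60 * (r * Z) + 81 * r + 19) fun s' => Ready m Z a b s' ∧
      Holds m s' (walkItems m r (fun v => a (torusIndex v)) fun v => b (torusIndex v)) := by
  have h8 : 1 ≤ 8 ^ r := Nat.one_le_pow _ _ (by norm_num)
  set n := m * m with hn
  set E := 8 ^ r with hE
  have l0 : (startItems m G).length = n := by simp [startItems, hn]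
  have len : ∀ (d : ZMod m × ZMod m → G) J, (mulItems d J).length = J.length := fun d J => by
    simp [mulItems]
  have hZ1 : n * E ≤ Z := by
    rw [hZ, mul_assoc E, ← mul_assoc n]
    exact Nat.le_mul_of_pos_right _ (by positivity)
  have hZ2 : n * E * E ≤ Z := by
    rw [hZ, ← mul_assoc n, ← mul_assoc n]
    exact Nat.le_mul_of_pos_right _ h8
  have hZ3 : n * E * E * E ≤ Z := by
    rw [hZ]
    exact le_of_eq (by ring)
  have hZ0 : n ≤ Z := (Nat.le_mul_of_pos_right _ h8).trans hZ1
  have mulA : ∀ {s : State G}, Ready m Z a b s → ∀ {J}, Holds m s J → J.length ≤ Z →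
      HaltsIn (mulCode 11) s (14 * Z + 4) fun s' => Ready m Z a b s' ∧
        Holds m s' (mulItems (fun v => a (torusIndex v)) J) := by
    intro s hs J hJ hl
    exact (haltsIn_mulCode hs (Or.inl rfl) hs.num_eleven le_rfl hs.left hJ hl).mono (by omega)
      fun _ h => h
  have mulB : ∀ {s : State G}, Ready m Z a b s → ∀ {J}, Holds m s J → J.length ≤ Z →
      HaltsIn (mulCode 12) s (14 * Z + 4) fun s' => Ready m Z a b s' ∧
        Holds m s' (mulItems (fun v => b (torusIndex v)) J) := by
    intro s hs J hJ hl
    exact (haltsIn_mulCode hs (Or.inr rfl) hs.num_twelve (by omega) hs.right hJ hl).mono (by omega)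
      fun _ h => h
  have bound : r * (20 * Z + 27) = 20 * (r * Z) + 27 * r := by ring
  refine HaltsIn.mono (HaltsIn.seq (mulA hs hJ (by rw [l0]; exact hZ0)) fun s ⟨hs, hJ⟩ =>
    HaltsIn.seq (haltsIn_repeat_mixCode r hs hJ (by rw [len, l0]; exact hZ1)) fun s ⟨hs, hJ⟩ =>
    HaltsIn.seq (mulB hs hJ (by rw [length_mixItems_iterate, len, l0]; exact hZ1))
      fun s ⟨hs, hJ⟩ =>
    HaltsIn.seq (haltsIn_repeat_mixCode r hs hJ
      (by rw [len, length_mixItems_iterate, len, l0]; exact hZ2)) fun s ⟨hs, hJ⟩ =>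
    HaltsIn.seq (mulA hs hJ
      (by rw [length_mixItems_iterate, len, length_mixItems_iterate, len, l0]; exact hZ2))
      fun s ⟨hs, hJ⟩ =>
    HaltsIn.seq (haltsIn_repeat_mixCode r hs hJ (by
      rw [len, length_mixItems_iterate, len, length_mixItems_iterate, len, l0]; exact hZ3))
      fun s ⟨hs, hJ⟩ => mulB hs hJ (by
      rw [length_mixItems_iterate, len, length_mixItems_iterate, len, length_mixItems_iterate, len,
        l0]; exact hZ3)) ?_ fun _ h => h
  rw [bound]
  omega

/-- The whole construction: prepare, walk, and append the inverses. -/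
def expanderCode (r : ℕ) : Program :=
  .seq (setupCode r) (.seq (walkCode r) (.seq (block [.add 8 21 21, .add 9 13 21, .add 10 13 21])
    (.seq copyInv (.instr (.add 0 13 13)))))

theorem computes_expanderCode (r : ℕ) (A B : List G) :
    ∃ m t, 64 * (A.length + B.length) ≤ m * m ∧ m * m ≤ 256 * (A.length + B.length) ∧
      t ≤ (100 + 90 * r) * (m * m * (8 ^ r * 8 ^ r * 8 ^ r) + 1) ∧
      ∃ S, S = (walkItems m r (fun v => altSeq A (torusIndex v))
        fun v => altSeq B (torusIndex v)).map Prod.snd ∧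
      Computes (expanderCode r) A B t (S ++ S.map fun s => s⁻¹) := by
  obtain ⟨m, hm1, hm2, hsetup⟩ := haltsIn_setupCode r A B
  set J := walkItems m r (fun v => altSeq A (torusIndex v)) fun v => altSeq B (torusIndex v)
    with hJdef
  set Z := m * m * (8 ^ r * 8 ^ r * 8 ^ r) with hZ
  have hlen : J.length = Z := length_walkItems m r _ _
  have hnZ : m * m ≤ Z := Nat.le_mul_of_pos_right _ (by positivity)
  have main : HaltsIn (expanderCode r) (input A B) ((100 + 90 * r) * (Z + 1)) fun s =>
      output s = J.map Prod.snd ++ (J.map Prod.snd).map fun s => s⁻¹ := by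
    refine HaltsIn.mono (HaltsIn.seq hsetup fun s ⟨hs, hJ⟩ => HaltsIn.seq
      (haltsIn_walkCode hs hJ hZ) fun s ⟨hs, hJ⟩ => HaltsIn.seq (b := 3) (b' := 5 * Z + 1 + 1)
      (Q := fun u => u.num 2 = 1 ∧ u.num 8 = 0 ∧ u.num 9 = Z ∧ u.num 10 = Z ∧ u.num 13 = Z ∧
        u.grp = s.grp) (haltsIn_block (by simp) ?_) fun u ⟨u2, u8, u9, u10, u13, ug⟩ => ?_)
      (b' := (100 + 90 * r) * (Z + 1)) ?_ fun _ h => h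
    · have s2 := hs.num_two
      have s21 := hs.num_zero
      have s13 := hJ.1
      rw [← hJdef, hlen] at s13
      simp [execs, Instr.exec, s2, s21, s13]
    · have hcopy := haltsIn_copyInv u2
      rw [u8, u9, u10] at hcopy
      refine HaltsIn.seq (hcopy.mono (by omega) fun _ h => h) ?_
      rintro v ⟨hv, -, vg, vinv, -⟩
      have v13 : v.num 13 = Z := by rw [hv 13] <;> simp [u13]
      refine ⟨1, _, .instr _ v, le_rfl, ?_⟩
      have e0 : (Instr.exec v (.add 0 13 13)).num 0 = Z + Z := by simp [Instr.exec, v13]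
      have eg : (Instr.exec v (.add 0 13 13)).grp = v.grp := rfl
      have eJ : J.map Prod.snd = (List.range Z).map v.grp := by
        refine List.ext_getElem (by simp [hlen]) fun i h1 h2 => ?_
        have hi : i < J.length := by simpa using h1
        have := (hJ.2 i J[i] (List.getElem?_eq_getElem hi)).2.2
        simp only [List.getElem_map, List.getElem_range]
        rw [vg i (by omega), ug, this]
      change (List.range _).map _ = _
      rw [e0, eg, List.range_add, List.map_append, eJ]
      congr 1
      rw [List.map_map, List.map_map]
      refine List.map_congr_left fun k hk => ?_
      have hk := List.mem_range.1 hk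
      have := vinv (by omega) k hk
      simpa using this
    · have e : (100 + 90 * r) * (Z + 1) = 100 * Z + 90 * (r * Z) + 90 * r + 100 := by ring
      rw [e]
      have : 0 ≤ r * Z := Nat.zero_le _
      omega
  obtain ⟨t, s, hr, ht, hs⟩ := main
  exact ⟨m, t, hm1, hm2, ht, _, rfl, s, hr, hs⟩

end GroupRAM

theorem mainTheorem6 :
    ∃ (P : GroupRAM.Program) (T : Polynomial ℕ) (C : ℕ),
      ∀ (G : Type*) [Group G] [Fintype G] (N : Subgroup G) [N.Normal]
        [Fintype N] [Fintype (G ⧸ N)] (A : List N) (B : List G),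
        IsExpandingGenerating (1 / 4) (A : Multiset N) →
        IsExpandingGenerating (1 / 4) (B.map (QuotientGroup.mk' N) : Multiset (G ⧸ N)) →
        ∃ (t : ℕ) (S : List G),
          GroupRAM.Computes P (A.map N.subtype) B t S ∧
          t ≤ T.eval (A.length + B.length) ∧
          S.length ≤ C * (A.length + B.length) ∧
          IsInverseClosed (S : Multiset G) ∧
          IsExpandingGenerating (1 / 4) (S : Multiset G) := by
  obtain ⟨r, hr⟩ := exists_mixing_exponent
  set E := 8 ^ r * 8 ^ r * 8 ^ r with hE
  refine ⟨GroupRAM.expanderCode r, Polynomial.C (100 + 90 * r) *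
    (Polynomial.X * Polynomial.C (256 * E) + 1), 512 * E, ?_⟩
  intro G _ _ N _ _ _ A B hA hB
  obtain ⟨m, t, hm1, hm2, ht, S, hS, hcomp⟩ :=
    GroupRAM.computes_expanderCode r (A.map N.subtype) B
  rw [List.length_map] at hm1 hm2
  have hZ : m * m * E ≤ (A.length + B.length) * (256 * E) := by
    calc m * m * E ≤ 256 * (A.length + B.length) * E := Nat.mul_le_mul_right _ hm2
      _ = _ := by ring
  refine ⟨t, _, hcomp, ht.trans ?_, ?_, isInverseClosed_append_inv S, ?_⟩
  · simp only [Polynomial.eval_mul, Polynomial.eval_add, Polynomial.eval_C, Polynomial.eval_X,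
      Polynomial.eval_one]
    gcongr
  · have hl : S.length = m * m * E := by rw [hS, List.length_map, length_walkItems]
    rw [List.length_append, List.length_map, hl]
    linarith
  · rcases Nat.eq_zero_or_pos m with h0 | hpos
    · subst h0
      have hL : A.length + B.length = 0 := by omega
      obtain rfl : A = [] := List.length_eq_zero_iff.1 (by omega)
      obtain rfl : B = [] := List.length_eq_zero_iff.1 (by omega)
      have hS0 : S = [] := by
        rw [← List.length_eq_zero_iff, hS, List.length_map, length_walkItems]
        simp
      rw [hS0]
      refine isExpandingGenerating_nil fun x => ?_
      have hx : x ∈ N :=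
        (QuotientGroup.eq_one_iff x).1 (eq_one_of_isExpandingGenerating_nil hB _)
      exact congrArg Subtype.val (eq_one_of_isExpandingGenerating_nil hA ⟨x, hx⟩)
    · have : NeZero m := ⟨hpos.ne'⟩
      rw [hS]
      exact isExpandingGenerating_walkItems N hA hB hm1 hr
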